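/- Code a lattice path starting at the origin and made of unit north and east steps by a word over $\{0,1\}$, where $1$ is a north (vertical) step and $0$ an east (horizontal) step. Such a path is called NW-convex if it begins and ends with a north step and there is no unit cell $[i,i+1]\times[j,j+1]$, $i,j\in\mathbb{Z}$, between the path and its upper convex hull, i.e. no unit cell that lies above the path and is included in the convex hull of the path. The number of initial vertical steps of a path is the length of the first block of $1$'s of its word (and is $0$ if the word does not begin with $1$). Then the expected number of initial vertical steps of a uniformly random NW-convex path of length $n$ is, as $n\to\infty$, asymptotically equivalent to $$\frac{\sqrt[3]{18\pi^2 n}}{6\sqrt[3]{\zeta(3)}},$$ where $\zeta$ is the Riemann zeta function. The same equivalent holds when the obligatory first north step is removed, that is, for the expected number of initial vertical steps of a word drawn uniformly among the words $w$ of length $n$ such that the word $1w$ codes an NW-convex path (the class with generating function $\prod_{m\ge 1}(1-z^m)^{-\varphi(m)}$, $\varphi$ being Euler's totient function). -/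

import Mathlib

open Filter Asymptotics

namespace NWPath

/-- A lattice path of north and east steps starting at the origin is coded by a word:
`true` (the letter 1) is a north step, `false` (the letter 0) is an east step.
`endpoint w` is the lattice point that the path coded by `w` reaches. -/
def endpoint (w : List Bool) : ℝ × ℝ := ((w.count false : ℝ), (w.count true : ℝ))

/-- The lattice points visited by the path coded by `w` (its origin and end included). Since the
path consists of the segments joining consecutive such points, its convex hull is the convex hull
of this set. -/
def vertices (w : List Bool) : Set (ℝ × ℝ) := {x | ∃ u : List Bool, u <+: w ∧ x = endpoint u}

/-- The closed unit cell `[i, i+1] × [j, j+1]` of the square lattice. -/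
def cell (i j : ℤ) : Set (ℝ × ℝ) :=
  Set.Icc (i : ℝ) ((i : ℝ) + 1) ×ˢ Set.Icc (j : ℝ) ((j : ℝ) + 1)

/-- The cell `[i, i+1] × [j, j+1]` lies above the path coded by `w`: the path has an east step
from `(i, h)` to `(i+1, h)` for some `h ≤ j`. -/
def CellAbove (w : List Bool) (i j : ℤ) : Prop :=
  ∃ u : List Bool, u ++ [false] <+: w ∧ (u.count false : ℤ) = i ∧ (u.count true : ℤ) ≤ j

/-- A path is NW-convex if it begins and ends with a north step and there is no cell between the
path and its upper convex hull, that is, no cell above the path which is included in the convex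
hull of the path. -/
structure IsNWConvex (w : List Bool) : Prop where
  begins_north : w.head? = some true
  ends_north : w.getLast? = some true
  no_cell_between : ∀ i j : ℤ, CellAbove w i j → ¬ cell i j ⊆ convexHull ℝ (vertices w)

/-- The number of initial vertical steps of a path: the size of the first block of 1 of its word. -/
def initialSteps (w : List Bool) : ℕ := (w.takeWhile (fun b => b)).length

theorem finite_length_and (P : List Bool → Prop) (n : ℕ) :
    {w : List Bool | w.length = n ∧ P w}.Finite :=
  (List.finite_length_eq Bool n).subset fun _ h => h.1

/-- The NW-convex paths of length `n`. -/
noncomputable def paths (n : ℕ) : Finset (List Bool) :=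
  (finite_length_and IsNWConvex n).toFinset

/-- The paths of length `n` obtained from an NW-convex path by removing its first step, which is
always a north step. -/
noncomputable def reducedPaths (n : ℕ) : Finset (List Bool) :=
  (finite_length_and (fun w => IsNWConvex (true :: w)) n).toFinset

/-- The expected number of initial vertical steps of a uniformly random element of `A`. -/
noncomputable def meanInitialSteps (A : Finset (List Bool)) : ℝ :=
  (∑ w ∈ A, (initialSteps w : ℝ)) / (A.card : ℝ)

end NWPath

/-! The proof is a bijection followed by a saddle point argument. Once its first north step is
removed, an NW-convex path splits uniquely into blocks of weakly decreasing slope. The block of a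
primitive vector (a, b), b > 0, is the highest lattice path from the origin to (a, b) below the
segment joining them. The cell condition becomes the arithmetic condition `NearlyConcave` in
`isNWConvex_cons_true_iff`, and the bijection rests on `nearlyConcave_wordOf`, `exists_wordOf_eq`
and `wordOf_injective`. So reduced paths of length n are multisets of primitive vectors of total
size n, where (a, b) has size a + b and φ(m) vectors have size m; the number of initial vertical
steps is the multiplicity of (0, 1).

Let c_n be the number of these multisets and a_k = Σ_{d ∣ k} d φ(d). Weighing all multisets gives n
c_n = Σ a_k c_{n-k}, hence C(z) = Σ c_n z^n = exp(Σ a_k z^k / k) (`tsum_coeff_mul_pow`). The mean is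
S_n / c_n with S_n = c_0 + ... + c_{n-1}, whose generating function is z C(z) / (1 - z).

Both c_n and S_n are Cauchy integrals over |z| = e^{-t}, with t the saddle point: Σ a_k e^{-kt} = n.
The mass concentrates at arguments θ of order t², much smaller than t, where z / (1 - z) ~ 1 / t.
Everything else is common to the two integrals, so S_n / c_n ~ 1 / t without any asymptotics for c_n
itself (`tendsto_saddle_integral`, `tendsto_saddle_ratio`).

Finally a_k is the Dirichlet convolution of 1, l μ(l) and e², so t³ Σ a_k e^{-kt} → 2 ζ(3) / ζ(2) as
t → 0 (`hasAbelLimit_totientSum`). Thus 1 / t ~ (n ζ(2) / (2 ζ(3)))^{1/3}, which is the stated value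
because ζ(2) = π² / 6. -/

namespace NWPath

/-! ### Greedy words of a direction -/

/-- The word of length `n` coding the highest lattice path below the ray of direction `(a, b)`. -/
def slopeWord (a b : ℕ) : ℕ → List Bool
  | 0 => []
  | n + 1 => slopeWord a b n ++
      [decide (((slopeWord a b n).count true + 1) * a ≤ b * (slopeWord a b n).count false)]

theorem length_slopeWord (a b n : ℕ) : (slopeWord a b n).length = n := by
  induction n with
  | zero => rfl
  | succ n ih => simp [slopeWord, ih]

theorem count_false_add_count_true (w : List Bool) : w.count false + w.count true = w.length := by
  induction w with
  | nil => rfl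
  | cons c w ih => cases c <;> simp <;> omega

theorem slopeWord_prefix (a b : ℕ) {m n : ℕ} (h : m ≤ n) : slopeWord a b m <+: slopeWord a b n := by
  induction n, h using Nat.le_induction with
  | base => exact List.prefix_rfl
  | succ n _ ih => exact ih.trans (List.prefix_append _ _)

theorem eq_slopeWord_of_prefix {a b n : ℕ} {p : List Bool} (h : p <+: slopeWord a b n) :
    p = slopeWord a b p.length := by
  have hl : p.length ≤ n := by simpa [length_slopeWord] using h.length_le
  have h2 := List.prefix_of_prefix_length_le h (slopeWord_prefix a b hl)
    (by rw [length_slopeWord])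
  exact h2.eq_of_length (by rw [length_slopeWord])

theorem slopeWord_mul (g a b n : ℕ) (hg : 0 < g) :
    slopeWord (g * a) (g * b) n = slopeWord a b n := by
  induction n with
  | zero => rfl
  | succ n ih =>
    have (x y : ℕ) : (y * (g * a) ≤ g * b * x) ↔ (y * a ≤ b * x) := by
      rw [mul_left_comm, mul_assoc]
      exact Nat.mul_le_mul_left_iff hg
    simp only [slopeWord, ih, this]

/-- The greedy rule keeps b x - a y in [0, a + b): a north step is taken only if the result is
nonnegative, an east step only if the value is below a. -/
theorem slopeWord_bounds (a b n : ℕ) (h : 0 < a + b) :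
    (slopeWord a b n).count true * a ≤ b * (slopeWord a b n).count false ∧
      b * (slopeWord a b n).count false < (slopeWord a b n).count true * a + a + b := by
  induction n with
  | zero => simpa [slopeWord] using h
  | succ n ih =>
    by_cases hc : ((slopeWord a b n).count true + 1) * a ≤ b * (slopeWord a b n).count false
    · simp only [slopeWord, hc, decide_true, List.count_append, List.count_cons, List.count_nil]
      simp
      constructor
      · exact hc
      · nlinarith [ih.2]
    · simp only [slopeWord, hc, decide_false, List.count_append, List.count_cons, List.count_nil]
      simp
      constructor <;> nlinarith [ih.1, ih.2]

/-- The word of length `a + b` below the vector `(a, b)`. -/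
def block (a b : ℕ) : List Bool := slopeWord a b (a + b)

/-- On the antidiagonal x + y = a + b, the quantity b x - a y changes by a + b from one lattice
point to the next, so only one point satisfies `slopeWord_bounds`, namely (a, b). Coprimality plays
no role. -/
theorem block_counts {a b : ℕ} (hb : 0 < b) :
    (block a b).count false = a ∧ (block a b).count true = b := by
  have h1 := slopeWord_bounds a b (a + b) (by omega)
  have h2 := count_false_add_count_true (block a b)
  rw [block, length_slopeWord] at h2
  rw [block]
  set x := (slopeWord a b (a + b)).count false
  set y := (slopeWord a b (a + b)).count true
  rcases lt_trichotomy x a with h | h | h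
  · exfalso
    obtain ⟨k, hk⟩ : ∃ k, y = b + 1 + k := ⟨y - b - 1, by omega⟩
    have hx : a = x + (k + 1) := by omega
    rw [hk] at h1
    nlinarith [h1.1, Nat.zero_le (k * a), Nat.zero_le (b * k)]
  · exact ⟨h, by omega⟩
  · exfalso
    obtain ⟨k, hk⟩ : ∃ k, b = y + 1 + k := ⟨b - y - 1, by omega⟩
    have hx : x = a + (k + 1) := by omega
    rw [hx] at h1
    nlinarith [h1.2, Nat.zero_le (k * a), Nat.zero_le (b * k)]

theorem slope_le_of_prefix_block {a b : ℕ} (hb : 0 < b) {p : List Bool} (h : p <+: block a b) :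
    p.count true * a ≤ b * p.count false := by
  rw [eq_slopeWord_of_prefix h]
  exact (slopeWord_bounds a b _ (by omega)).1

theorem letter_of_prefix_slopeWord {a b n : ℕ} {p : List Bool} {c : Bool}
    (h : p ++ [c] <+: slopeWord a b n) :
    c = decide ((p.count true + 1) * a ≤ b * p.count false) := by
  have h1 := eq_slopeWord_of_prefix h
  have h2 := eq_slopeWord_of_prefix ((List.prefix_append p [c]).trans h)
  rw [List.length_append, List.length_singleton, slopeWord, ← h2] at h1
  simpa using h1

theorem eq_slopeWord {a b : ℕ} (u : List Bool)
    (h : ∀ q c, q ++ [c] <+: u → c = decide ((q.count true + 1) * a ≤ b * q.count false)) :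
    u = slopeWord a b u.length := by
  induction u using List.reverseRecOn with
  | nil => rfl
  | append_singleton u c ih =>
    have h1 := ih fun q c hq => h q c (hq.trans (List.prefix_append _ _))
    rw [List.length_append, List.length_singleton, slopeWord, ← h1, ← h u c List.prefix_rfl]

theorem block_ne_nil {a b : ℕ} (hb : 0 < b) : block a b ≠ [] := by
  intro h
  have := length_slopeWord a b (a + b)
  rw [← block, h] at this
  simp at this
  omega

/-- A final east step would start at (a - 1, b), which is above the ray. -/
theorem block_getLast? {a b : ℕ} (hb : 0 < b) : (block a b).getLast? = some true := by
  obtain ⟨u, c, huc⟩ := List.eq_nil_or_concat (block a b) |>.resolve_left (block_ne_nil hb)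
  rw [List.concat_eq_append] at huc
  have h0 : u <+: block a b := huc ▸ List.prefix_append _ _
  have h1 := slope_le_of_prefix_block hb h0
  have h2 := block_counts (a := a) hb
  rw [huc] at h2 ⊢
  cases c with
  | true => simp
  | false =>
    exfalso
    simp at h2
    rw [h2.2, ← h2.1] at h1
    nlinarith

theorem head_block {a b : ℕ} (ha : 0 < a) : ∃ t, block a b = false :: t := by
  have h : slopeWord a b 1 <+: block a b := slopeWord_prefix a b (by omega)
  have h1 : slopeWord a b 1 = [false] := by simp [slopeWord]; omega
  rw [h1] at h
  obtain ⟨t, ht⟩ := h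
  exact ⟨t, ht.symm⟩

/-! ### Nearly concave words -/

/-- The path coded by `w` passes above, or less than one unit below, each of its chords
at the start of each of its east steps. -/
def NearlyConcave (w : List Bool) : Prop :=
  ∀ p q r : List Bool, p <+: q → q ++ [false] <+: r → r <+: w →
    ((q.count false : ℤ) - p.count false) * r.count true
      + ((r.count false : ℤ) - q.count false) * p.count true
      < ((r.count false : ℤ) - p.count false) * (q.count true + 1)

theorem prefix_append_cases {p u w : List Bool} (h : p <+: u ++ w) :
    p <+: u ∨ ∃ p', p = u ++ p' ∧ p' <+: w := by
  rcases List.prefix_or_prefix_of_prefix h (List.prefix_append u w) with h' | ⟨p', rfl⟩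
  · exact Or.inl h'
  · exact Or.inr ⟨p', rfl, (List.prefix_append_right_inj u).1 h⟩

theorem NearlyConcave.of_append {u w : List Bool} (h : NearlyConcave (u ++ w)) :
    NearlyConcave w := by
  intro p q r hp hq hr
  have h1 := h (u ++ p) (u ++ q) (u ++ r) ((List.prefix_append_right_inj u).2 hp)
    (by rw [List.append_assoc]; exact (List.prefix_append_right_inj u).2 hq)
    ((List.prefix_append_right_inj u).2 hr)
  simp only [List.count_append] at h1
  push_cast at h1
  nlinarith

theorem count_false_lt {q r : List Bool} (h : q ++ [false] <+: r) :
    q.count false < r.count false := by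
  have := h.sublist.count_le false
  simp at this
  omega

/-- A chord starting on the added step lies at or below the chord with the same end that starts at
the top of that step, and the latter is a chord of `w` shifted up by one. -/
theorem NearlyConcave.cons_true {w : List Bool} (h : NearlyConcave w) :
    NearlyConcave (true :: w) := by
  intro p q r hp hq hr
  rcases prefix_append_cases (u := [true]) hr with hr | ⟨r, rfl, hr'⟩
  · have h1 := (hq.trans hr).sublist.count_le false
    simp at h1
  rcases prefix_append_cases hq with hq' | ⟨q', e, hq'⟩
  · have h1 := hq'.sublist.count_le false
    simp at h1
  obtain ⟨q, rfl, rfl⟩ : ∃ q0, q' = q0 ++ [false] ∧ q = true :: q0 := by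
    cases q with
    | nil => simp at e
    | cons c q =>
      simp at e
      exact ⟨q, e.2.symm, by rw [e.1]⟩
  have hlt := count_false_lt hq'
  rcases prefix_append_cases (u := [true]) hp with hp | ⟨p, rfl, hp'⟩
  · have h1 := h [] q r List.nil_prefix hq' hr'
    have h2 := hp.sublist.count_le false
    have h3 := hp.sublist.count_le true
    have h4 : (0 : ℤ) ≤ (r.count false : ℤ) - q.count false := by omega
    simp at h1 h2 h3 ⊢
    rw [h2]
    have h5 : (p.count true : ℤ) ≤ 1 := by exact_mod_cast h3
    push_cast
    nlinarith [mul_le_mul_of_nonneg_left h5 h4]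
  · have h1 := h p q r hp' hq' hr'
    simp at h1 ⊢
    nlinarith

/-! ### Directions and sorted lists of directions -/

/-- Primitive vectors which are not horizontal, with nonnegative coordinates. -/
abbrev Dir : Type := {v : ℕ × ℕ // Nat.Coprime v.1 v.2 ∧ 0 < v.2}

/-- `v` is at least as steep as `w`. -/
def steeper (v w : Dir) : Prop := w.1.2 * v.1.1 ≤ v.1.2 * w.1.1

instance : DecidableRel steeper := fun v w => by unfold steeper; infer_instance

theorem steeper_antisymm {v w : Dir} (h1 : steeper v w) (h2 : steeper w v) : v = w := by
  obtain ⟨⟨a, b⟩, hab, hb⟩ := v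
  obtain ⟨⟨c, d⟩, hcd, hd⟩ := w
  simp only [steeper] at *
  have h : d * a = b * c := le_antisymm h1 h2
  have h3 : b ∣ d := hab.symm.dvd_of_dvd_mul_right (Dvd.intro _ h.symm)
  have h4 : d ∣ b := hcd.symm.dvd_of_dvd_mul_right (Dvd.intro _ h)
  obtain rfl := Nat.dvd_antisymm h3 h4
  obtain rfl := Nat.eq_of_mul_eq_mul_left hb h
  rfl

instance : Std.Antisymm steeper := ⟨fun _ _ => steeper_antisymm⟩

instance : Std.Total steeper := ⟨fun _ _ => le_total _ _⟩

/-- Slope comparison in cross-multiplied form is transitive by cancelling the middle abscissa `a`.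
For a vertical middle vector this fails in general; `h0` then makes it nonzero, which forces `c =
0`. -/
theorem slope_trans {a b c d x y : ℕ} (h0 : 0 < a ∨ (y ≤ b ∧ 0 < b)) (h1 : y * a ≤ b * x)
    (h2 : b * c ≤ d * a) : y * c ≤ d * x := by
  rcases Nat.eq_zero_or_pos a with rfl | ha
  · obtain ⟨hy, hb⟩ := h0.resolve_left (lt_irrefl 0)
    have : c = 0 := by
      rcases Nat.eq_zero_or_pos c with h | h
      · exact h
      · nlinarith [Nat.mul_pos hb h]
    simp [this]
  · refine Nat.le_of_mul_le_mul_right (c := a) ?_ ha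
    calc y * c * a = y * a * c := by ring
      _ ≤ b * x * c := Nat.mul_le_mul_right _ h1
      _ = b * c * x := by ring
      _ ≤ d * a * x := Nat.mul_le_mul_right _ h2
      _ = d * x * a := by ring

instance : IsTrans Dir steeper where
  trans u v w h1 h2 := by
    unfold steeper at *
    rcases Nat.eq_zero_or_pos v.1.1 with h | h
    · have h3 : u.1.1 = 0 := by
        rw [h] at h1
        have := v.2.2
        rcases Nat.eq_zero_or_pos u.1.1 with h' | h'
        · exact h'
        · nlinarith [Nat.mul_pos this h']
      simp [h3]
    · exact slope_trans (Or.inl h) h2 h1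

/-- The word coding the path whose upper hull has the edges in `l`. -/
def wordOf : List Dir → List Bool
  | [] => []
  | v :: l => block v.1.1 v.1.2 ++ wordOf l

/-- Each block stays below its own direction, so a bound on all slopes of `l` bounds the whole path.
Taken with the first direction of a sorted list, it says that the path stays below the ray of its
first block. -/
theorem slope_le_of_prefix_wordOf {c d : ℕ} (l : List Dir)
    (h : ∀ v ∈ l, v.1.2 * c ≤ d * v.1.1) {p : List Bool} (hp : p <+: wordOf l) :
    p.count true * c ≤ d * p.count false := by
  induction l generalizing p with
  | nil =>
    rw [wordOf, List.prefix_nil] at hp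
    simp [hp]
  | cons v l ih =>
    have hb := v.2.2
    rw [wordOf] at hp
    rcases prefix_append_cases hp with hp | ⟨p, rfl, hp'⟩
    · refine slope_trans ?_ (slope_le_of_prefix_block hb hp) (h v (by simp))
      refine Or.inr ⟨?_, hb⟩
      have := hp.sublist.count_le true
      rwa [(block_counts hb).2] at this
    · have h1 := ih (fun v hv => h v (by simp [hv])) hp'
      have h2 := h v (by simp)
      rw [List.count_append, List.count_append, (block_counts hb).1, (block_counts hb).2]
      nlinarith

theorem length_wordOf (l : List Dir) :
    (wordOf l).length = (l.map fun v => v.1.1 + v.1.2).sum := by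
  induction l with
  | nil => rfl
  | cons v l ih => simp [wordOf, ih, block, length_slopeWord]

theorem wordOf_getLast? (l : List Dir) : wordOf l = [] ∨ (wordOf l).getLast? = some true := by
  induction l with
  | nil => exact Or.inl rfl
  | cons v l ih =>
    right
    rcases ih with h | h
    · rw [wordOf, h, List.append_nil, block_getLast? v.2.2]
    · rw [wordOf, List.getLast?_append, h]
      rfl

/-- Both ends of the chord lie below the ray, hence so does the chord at `x2`, where the ray is less
than one unit above the path. -/
theorem chord_lt_of_below {a b x1 y1 x2 y2 x3 y3 : ℤ} (ha : 0 ≤ a) (h12 : x1 ≤ x2) (h23 : x2 < x3)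
    (hx : 0 ≤ x2) (hb : 0 ≤ b)
    (h1 : y1 * a ≤ b * x1) (h2 : b * x2 < (y2 + 1) * a) (h3 : y3 * a ≤ b * x3) :
    (x2 - x1) * y3 + (x3 - x2) * y1 < (x3 - x1) * (y2 + 1) := by
  have ha' : 0 < a := by
    rcases ha.eq_or_lt with rfl | h
    · nlinarith [mul_nonneg hb hx]
    · exact h
  refine lt_of_mul_lt_mul_right (a := a) ?_ ha
  have e1 := mul_le_mul_of_nonneg_left h3 (sub_nonneg.2 h12)
  have e2 := mul_le_mul_of_nonneg_left h1 (sub_nonneg.2 h23.le)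
  have e3 := mul_lt_mul_of_pos_left h2 (sub_pos.2 (h12.trans_lt h23))
  nlinarith

/-- Both ends lie below the ray through (a, b), so the chord passes at or below (a, b) (this is
`key`). To the right of `a` it is therefore dominated by the chord from (a, b) to the same right
end. -/
theorem chord_lt_of_chord_lt {a b x1 y1 x2 y2 x3 y3 : ℤ} (ha : 0 ≤ a) (h1a : x1 ≤ a) (h2a : a ≤ x2)
    (hx1 : 0 ≤ x1) (h23 : x2 < x3) (hy1 : y1 ≤ b) (h1 : y1 * a ≤ b * x1) (h3 : y3 * a ≤ b * x3)
    (h : (x2 - a) * y3 + (x3 - x2) * b < (x3 - a) * (y2 + 1)) :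
    (x2 - x1) * y3 + (x3 - x2) * y1 < (x3 - x1) * (y2 + 1) := by
  rcases h1a.eq_or_lt with rfl | h1a
  · nlinarith
  have ha' : 0 < a := by omega
  have key : (a - x1) * y3 + (x3 - a) * y1 ≤ (x3 - x1) * b := by
    refine le_of_mul_le_mul_right ?_ ha'
    have e1 := mul_le_mul_of_nonneg_left h3 (sub_nonneg.2 h1a.le)
    have e2 := mul_le_mul_of_nonneg_left h1 (sub_nonneg.2 (h2a.trans h23.le))
    nlinarith
  refine lt_of_mul_lt_mul_left (a := x3 - a) ?_ (by omega)
  have e1 := mul_le_mul_of_nonneg_left key (sub_nonneg.2 h23.le)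
  have e2 := mul_lt_mul_of_pos_left h (show 0 < x3 - x1 by omega)
  nlinarith

/-- Induction on the list; the whole path lies below the ray of the first block. An east step in
that block was taken because a north step would cross the ray, so `chord_lt_of_below` applies. For a
later east step the induction hypothesis applies, directly if the chord starts after the first block
and through `chord_lt_of_chord_lt` otherwise. -/
theorem nearlyConcave_wordOf (l : List Dir) (hl : l.Pairwise steeper) :
    NearlyConcave (wordOf l) := by
  induction l with
  | nil =>
    intro p q r hp hq hr
    rw [wordOf, List.prefix_nil] at hr
    rw [hr, List.prefix_nil] at hq
    simp at hq
  | cons v l ih =>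
    obtain ⟨hv, htail⟩ := List.pairwise_cons.1 hl
    obtain ⟨⟨a, b⟩, hab, hb⟩ := v
    have below : ∀ p, p <+: block a b ++ wordOf l → (p.count true : ℤ) * a ≤ b * p.count false := by
      intro p hp
      have h := slope_le_of_prefix_wordOf (c := a) (d := b) (⟨⟨a, b⟩, hab, hb⟩ :: l) ?_ hp
      · exact_mod_cast h
      · intro v hv'
        rcases List.mem_cons.1 hv' with rfl | h
        · exact le_rfl
        · exact hv v h
    obtain ⟨hca, hcb⟩ := block_counts (a := a) hb
    intro p q r hp hq hr
    rw [wordOf] at hr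
    dsimp only at hr
    have hqr := count_false_lt hq
    rcases prefix_append_cases (hq.trans hr) with hq1 | ⟨q', e, hq'⟩
    · have h2 := letter_of_prefix_slopeWord hq1
      have h2' : b * q.count false < (q.count true + 1) * a := by simpa using h2
      exact chord_lt_of_below (a := a) (b := b) (by positivity)
        (by exact_mod_cast hp.sublist.count_le false)
        (by exact_mod_cast hqr) (by positivity) (by positivity)
        (below p (hp.trans ((List.prefix_append _ _).trans (hq.trans hr)))) (by exact_mod_cast h2')
        (below r hr)
    -- With `q'` empty the east step would be the last letter of the first block, and the argument
    -- for that block still covers it.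
    · rcases List.eq_nil_or_concat q' with rfl | ⟨q0, c, rfl⟩
      · have h2 : q ++ [false] <+: block a b := by rw [e, List.append_nil]
        have h2' : b * q.count false < (q.count true + 1) * a := by
          simpa using letter_of_prefix_slopeWord h2
        exact chord_lt_of_below (a := a) (b := b) (by positivity)
          (by exact_mod_cast hp.sublist.count_le false)
          (by exact_mod_cast hqr) (by positivity) (by positivity)
          (below p (hp.trans ((List.prefix_append _ _).trans (hq.trans hr))))
          (by exact_mod_cast h2') (below r hr)
      · rw [List.concat_eq_append] at e hq'
        rw [← List.append_assoc] at e
        obtain ⟨rfl, hc⟩ := List.append_inj' e rfl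
        obtain rfl : false = c := by simpa using hc
        obtain ⟨s, rfl⟩ := hq
        have hr' : q0 ++ [false] ++ s <+: wordOf l := by
          rw [List.append_assoc, List.append_assoc, List.prefix_append_right_inj] at hr
          rwa [List.append_assoc]
        rcases prefix_append_cases hp with hp | ⟨p, rfl, hp'⟩
        · have h1 := ih htail [] q0 (q0 ++ [false] ++ s) List.nil_prefix (List.prefix_append _ _) hr'
          have h2 := below _ hr
          have h3 := below p (hp.trans (List.prefix_append _ _))
          have h4 := hp.sublist.count_le false
          have h5 := hp.sublist.count_le true
          rw [hca] at h4
          rw [hcb] at h5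
          simp only [List.count_append, hca, hcb] at h1 h2 h3 hqr ⊢
          push_cast at h1 h2 h3 hqr ⊢
          refine chord_lt_of_chord_lt (a := a) (b := b) (by positivity) (by exact_mod_cast h4)
            (by linarith [Int.natCast_nonneg (q0.count false)]) (by positivity)
            (by exact_mod_cast hqr) (by exact_mod_cast h5) h3 h2 ?_
          simp at h1 ⊢
          nlinarith
        · have h1 := ih htail p q0 (q0 ++ [false] ++ s) hp' (List.prefix_append _ _) hr'
          simp only [List.count_append] at h1 ⊢
          push_cast at h1 ⊢
          nlinarith

/-- The first direction can be read off the word: the end of the first block of either list lies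
below the ray of the first direction of the other, so the two directions are equally steep. -/
theorem wordOf_injective {l l' : List Dir} (hl : l.Pairwise steeper) (hl' : l'.Pairwise steeper)
    (h : wordOf l = wordOf l') : l = l' := by
  induction l generalizing l' with
  | nil =>
    cases l' with
    | nil => rfl
    | cons v l' =>
      have := block_ne_nil (a := v.1.1) v.2.2
      simp [wordOf] at h
      exact absurd h.1 this
  | cons v l ih =>
    cases l' with
    | nil =>
      have := block_ne_nil (a := v.1.1) v.2.2
      simp [wordOf] at h
      exact absurd h.1 this
    | cons v' l' =>
      have key : ∀ {v v' : Dir} {l l' : List Dir}, (v :: l).Pairwise steeper →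
          wordOf (v :: l) = wordOf (v' :: l') → steeper v v' := by
        intro v v' l l' hl h
        have h1 : block v'.1.1 v'.1.2 <+: wordOf (v :: l) := by
          rw [h]; exact List.prefix_append _ _
        have h2 := slope_le_of_prefix_wordOf (c := v.1.1) (d := v.1.2) (v :: l) ?_ h1
        · rwa [(block_counts v'.2.2).1, (block_counts v'.2.2).2] at h2
        · intro w hw
          rcases List.mem_cons.1 hw with rfl | hw
          · exact le_rfl
          · exact (List.pairwise_cons.1 hl).1 w hw
      obtain rfl := steeper_antisymm (key hl h) (key hl' h.symm)
      rw [ih (List.pairwise_cons.1 hl).2 (List.pairwise_cons.1 hl').2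
        (List.append_cancel_left h)]

/-! ### Factorization of nearly concave words into blocks. -/

theorem exists_steepest_prefix {w : List Bool} (hw : w ≠ []) :
    ∃ u, u <+: w ∧ u ≠ [] ∧
      (∀ p, p <+: w → p ≠ [] → p.count true * u.count false ≤ u.count true * p.count false) ∧
      ∀ p, p <+: w → p ≠ [] → p.length < u.length →
        p.count true * u.count false < u.count true * p.count false := by
  have hfin : {p : List Bool | p <+: w ∧ p ≠ []}.Finite :=
    (List.finite_toSet w.inits).subset fun p hp => (List.mem_inits p w).2 hp.1
  -- The ratio y / (x + y) orders directions as the slope y / x does, without dividing by zero on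
  -- vertical prefixes. The prefix sought is the shortest one of maximal slope.
  have hkey (p u : List Bool) (hp : p ≠ []) (hu : u ≠ []) :
      (p.count true : ℚ) / p.length ≤ u.count true / u.length ↔
        p.count true * u.count false ≤ u.count true * p.count false := by
    have h1 : (0 : ℚ) < p.length := by exact_mod_cast List.length_pos_iff.2 hp
    have h2 : (0 : ℚ) < u.length := by exact_mod_cast List.length_pos_iff.2 hu
    rw [div_le_div_iff₀ h1 h2, ← count_false_add_count_true p, ← count_false_add_count_true u]
    norm_cast
    constructor <;> intro h <;> nlinarith
  obtain ⟨u0, hu0, hmax⟩ := Set.exists_max_image _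
    (fun p : List Bool => (p.count true : ℚ) / p.length) hfin ⟨w, List.prefix_rfl, hw⟩
  obtain ⟨u, ⟨hu, hu1⟩, hmin⟩ := Set.exists_min_image
    {p : List Bool | (p <+: w ∧ p ≠ []) ∧ (u0.count true : ℚ) / u0.length ≤ p.count true / p.length}
    List.length (hfin.subset fun p hp => hp.1) ⟨u0, hu0, le_rfl⟩
  refine ⟨u, hu.1, hu.2, fun p hp hp' => (hkey p u hp' hu.2).1 ((hmax p ⟨hp, hp'⟩).trans hu1),
    fun p hp hp' hlt => ?_⟩
  by_contra hcon
  have h1 := hu1.trans ((hkey u p hu.2 hp').2 (by linarith [not_lt.1 hcon]))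
  exact absurd (hmin p ⟨⟨hp, hp'⟩, h1⟩) (not_le.2 hlt)

/-- The shortest steepest prefix `u`, ending at (a, b), is a primitive block. Its north steps stay
below the ray by maximality of the slope, and its east steps are forced by near concavity along the
chord from the origin to (a, b); hence `u` is greedy. If g = gcd(a, b) were at least 2, the greedy
word would reach (a/g, b/g) first, a shorter prefix of the same slope. -/
theorem exists_block_prefix {w : List Bool} (hw : NearlyConcave w) (hlast : w.getLast? = some true) :
    ∃ v : Dir, block v.1.1 v.1.2 <+: w ∧
      ∀ p, p <+: w → p.count true * v.1.1 ≤ v.1.2 * p.count false := by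
  have hne : w ≠ [] := by rintro rfl; simp at hlast
  obtain ⟨u, hu, hune, hmax, hlt⟩ := exists_steepest_prefix hne
  set a := u.count false with ha
  set b := u.count true with hb
  have hab : a + b = u.length := count_false_add_count_true u
  have hlen : 0 < a + b := hab ▸ List.length_pos_iff.2 hune
  have hbpos : 0 < b := by
    have h1 := hmax w List.prefix_rfl hne
    have h2 : 0 < w.count true := List.count_pos_iff.2 (List.mem_of_getLast? hlast)
    rcases Nat.eq_zero_or_pos b with h | h
    · rw [h] at h1 hlen
      nlinarith
    · exact h
  have hgreedy : u = block a b := by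
    rw [block, hab]
    refine eq_slopeWord u fun q c hq => ?_
    cases c with
    | true =>
      have := hmax (q ++ [true]) (hq.trans hu) (by simp)
      simpa using this
    | false =>
      have := hw [] q u List.nil_prefix hq hu
      simp only [List.count_nil, ← ha, ← hb] at this
      have h2 : b * q.count false < (q.count true + 1) * a := by
        zify
        push_cast at this
        nlinarith
      simpa using h2
  have hcop : Nat.Coprime a b := by
    obtain ⟨a', b', hcop, ha', hb'⟩ := Nat.exists_coprime a b
    by_contra hcon
    have hg2 : 2 ≤ a.gcd b := by
      have : a.gcd b ≠ 1 := hcon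
      have := Nat.gcd_pos_of_pos_right a hbpos
      omega
    have hg : 0 < a.gcd b := by omega
    set g := a.gcd b
    have hb0 : 0 < b' := by
      rcases Nat.eq_zero_or_pos b' with h | h
      · rw [h, Nat.zero_mul] at hb'; omega
      · exact h
    have e : slopeWord a b (a' + b') = block a' b' := by
      rw [block, ← slopeWord_mul g a' b' _ hg, mul_comm g, mul_comm g]
      exact congrArg₂ (fun x y => slopeWord x y (a' + b')) ha' hb'
    have hle : a' + b' < a + b := by nlinarith
    have hpre : block a' b' <+: u := by
      rw [← e, hgreedy]
      exact slopeWord_prefix a b hle.le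
    have h1 := hlt _ (hpre.trans hu) (block_ne_nil hb0) (by rw [block, length_slopeWord]; omega)
    rw [(block_counts hb0).1, (block_counts hb0).2] at h1
    have h2 : b' * a = b * a' := by
      calc b' * a = b' * (a' * g) := congrArg _ ha'
        _ = b' * g * a' := by ring
        _ = b * a' := congrArg (· * a') hb'.symm
    omega
  refine ⟨⟨(a, b), hcop, hbpos⟩, hgreedy ▸ hu, fun p hp => ?_⟩
  rcases eq_or_ne p [] with rfl | hp'
  · simp
  · exact hmax p hp hp'

theorem exists_wordOf_eq (w : List Bool) (hw : NearlyConcave w)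
    (hlast : w = [] ∨ w.getLast? = some true) :
    ∃ l : List Dir, l.Pairwise steeper ∧ wordOf l = w := by
  induction hn : w.length using Nat.strong_induction_on generalizing w with
  | _ n ih =>
    rcases hlast with rfl | hlast
    · exact ⟨[], List.Pairwise.nil, rfl⟩
    obtain ⟨v, ⟨t, rfl⟩, hv⟩ := exists_block_prefix hw hlast
    have hb := v.2.2
    have ht : t = [] ∨ t.getLast? = some true := by
      rw [List.getLast?_append] at hlast
      rcases List.eq_nil_or_concat t with h | ⟨t', c, h⟩
      · exact Or.inl h
      · right
        rw [h] at hlast ⊢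
        simpa using hlast
    obtain ⟨l, hl, rfl⟩ := ih t.length (by
      rw [← hn, List.length_append]
      have := List.length_pos_iff.2 (block_ne_nil (a := v.1.1) hb)
      omega) t hw.of_append ht rfl
    refine ⟨v :: l, ?_, rfl⟩
    -- The end of the second block is also below the ray of `v`, the steepest direction of the word.
    have hstep : ∀ (v' : Dir) (l' : List Dir), l = v' :: l' → steeper v v' := by
      rintro v' l' rfl
      have h1 := hv (block v.1.1 v.1.2 ++ block v'.1.1 v'.1.2)
        ((List.prefix_append_right_inj _).2 (List.prefix_append _ _))
      rw [List.count_append, List.count_append, (block_counts hb).1, (block_counts hb).2,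
        (block_counts v'.2.2).1, (block_counts v'.2.2).2] at h1
      unfold steeper
      nlinarith
    rw [List.pairwise_cons]
    refine ⟨fun w hw => ?_, hl⟩
    cases l with
    | nil => simp at hw
    | cons v' l' =>
      rcases List.mem_cons.1 hw with rfl | h
      · exact hstep _ _ rfl
      · exact _root_.trans (hstep _ _ rfl) ((List.pairwise_cons.1 hl).1 w h)

/-- The vertical unit vector. -/
def north : Dir := ⟨(0, 1), by decide⟩

/-- Copies of `north` come first in a sorted list, and every other block begins with an east step.
-/
theorem initialSteps_wordOf (l : List Dir) (hl : l.Pairwise steeper) :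
    initialSteps (wordOf l) = l.count north := by
  induction l with
  | nil => rfl
  | cons v l ih =>
    obtain ⟨hv, htail⟩ := List.pairwise_cons.1 hl
    by_cases h : v = north
    · subst h
      have : wordOf (north :: l) = true :: wordOf l := rfl
      rw [this, List.count_cons_self, ← ih htail]
      simp [initialSteps]
    · have ha : 0 < v.1.1 := by
        rcases Nat.eq_zero_or_pos v.1.1 with h0 | h0
        · exfalso
          apply h
          have h1 := v.2.1
          rw [h0, Nat.coprime_zero_left] at h1
          exact Subtype.ext (Prod.ext h0 h1)
        · exact h0
      obtain ⟨t, ht⟩ := head_block (b := v.1.2) ha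
      have h1 : initialSteps (wordOf (v :: l)) = 0 := by
        rw [wordOf, ht]
        simp [initialSteps]
      rw [h1, eq_comm, List.count_eq_zero]
      intro hmem
      rcases List.mem_cons.1 hmem with h2 | h2
      · exact h h2.symm
      · have := hv north h2
        simp [steeper, north] at this
        omega

end NWPath

namespace NWPath

/-! ### Cells in the convex hull of a path -/

theorem mem_of_vertical {C : Set (ℝ × ℝ)} (hC : Convex ℝ C) {x y₁ y₂ y : ℝ}
    (h1 : (x, y₁) ∈ C) (h2 : (x, y₂) ∈ C) (hy₁ : y₁ ≤ y) (hy₂ : y ≤ y₂) : (x, y) ∈ C := by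
  rcases hy₁.eq_or_lt with rfl | hlt
  · exact h1
  have hpos : 0 < y₂ - y₁ := by linarith
  convert hC h1 h2 (a := (y₂ - y) / (y₂ - y₁)) (b := (y - y₁) / (y₂ - y₁))
    (div_nonneg (by linarith) hpos.le) (div_nonneg (by linarith) hpos.le)
    (by field_simp; ring) using 1
  ext <;> simp <;> field_simp <;> ring

theorem mem_of_horizontal {C : Set (ℝ × ℝ)} (hC : Convex ℝ C) {y x₁ x₂ x : ℝ}
    (h1 : (x₁, y) ∈ C) (h2 : (x₂, y) ∈ C) (hx₁ : x₁ ≤ x) (hx₂ : x ≤ x₂) : (x, y) ∈ C := by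
  rcases hx₁.eq_or_lt with rfl | hlt
  · exact h1
  have hpos : 0 < x₂ - x₁ := by linarith
  convert hC h1 h2 (a := (x₂ - x) / (x₂ - x₁)) (b := (x - x₁) / (x₂ - x₁))
    (div_nonneg (by linarith) hpos.le) (div_nonneg (by linarith) hpos.le)
    (by field_simp; ring) using 1
  ext <;> simp <;> field_simp <;> ring

theorem mem_of_chord {C : Set (ℝ × ℝ)} (hC : Convex ℝ C) {x₁ y₁ x₂ y₂ x : ℝ}
    (h1 : (x₁, y₁) ∈ C) (h2 : (x₂, y₂) ∈ C) (hx₁ : x₁ ≤ x) (hx₂ : x ≤ x₂) (hlt : x₁ < x₂) :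
    (x, ((x₂ - x) * y₁ + (x - x₁) * y₂) / (x₂ - x₁)) ∈ C := by
  have hpos : 0 < x₂ - x₁ := by linarith
  convert hC h1 h2 (a := (x₂ - x) / (x₂ - x₁)) (b := (x - x₁) / (x₂ - x₁))
    (div_nonneg (by linarith) hpos.le) (div_nonneg (by linarith) hpos.le)
    (by field_simp; ring) using 1
  ext
  · simp
    field_simp
    ring
  · simp
    field_simp

/-- A lexicographic half-plane: the open half-plane below a line through (x₀, y₀), plus the open
right-hand ray of the line. It omits (x₀, y₀) but allows vertices on the line to its right, as a
supporting line requires. -/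
theorem convex_lex_halfPlane (s x₀ y₀ : ℝ) :
    Convex ℝ {z : ℝ × ℝ | z.2 - y₀ < s * (z.1 - x₀) ∨ (z.2 - y₀ = s * (z.1 - x₀) ∧ x₀ < z.1)} := by
  rw [convex_iff_forall_pos]
  rintro ⟨x, y⟩ h1 ⟨x', y'⟩ h2 a b ha hb hab
  obtain rfl : b = 1 - a := by linarith
  simp only [Set.mem_ofPred_eq, Prod.smul_mk, Prod.mk_add_mk, smul_eq_mul] at *
  rcases h1 with h1 | ⟨h1, h1'⟩ <;> rcases h2 with h2 | ⟨h2, h2'⟩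
  · left; nlinarith [mul_lt_mul_of_pos_left h1 ha, mul_lt_mul_of_pos_left h2 hb]
  · left; nlinarith [mul_lt_mul_of_pos_left h1 ha]
  · left; nlinarith [mul_lt_mul_of_pos_left h2 hb]
  · right
    constructor
    · linear_combination a * h1 + (1 - a) * h2
    · nlinarith [mul_lt_mul_of_pos_left h1' ha, mul_lt_mul_of_pos_left h2' hb]

/-- The top left corner of the cell is outside the hull. Take the line through the point one unit
above the start of the east step, with the largest slope `s` towards a later vertex. Later vertices
are on or below it, and near concavity puts the earlier ones strictly below. -/
theorem NearlyConcave.not_cell_subset {w : List Bool} (hw : NearlyConcave w) (i j : ℤ)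
    (h : CellAbove w i j) : ¬ cell i j ⊆ convexHull ℝ (vertices w) := by
  obtain ⟨u, hu, rfl, hj⟩ := h
  intro hsub
  have hfin : {r : List Bool | u ++ [false] <+: r ∧ r <+: w}.Finite :=
    (List.finite_toSet w.inits).subset fun p hp => (List.mem_inits p w).2 hp.2
  obtain ⟨r₀, ⟨hr₀, hr₀'⟩, hmax⟩ := Set.exists_max_image _
    (fun r : List Bool => ((r.count true : ℝ) - (u.count true + 1)) / (r.count false - u.count false))
    hfin ⟨u ++ [false], List.prefix_rfl, hu⟩
  set s := ((r₀.count true : ℝ) - (u.count true + 1)) / (r₀.count false - u.count false) with hs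
  have hpos : ∀ r, u ++ [false] <+: r → (0 : ℝ) < r.count false - u.count false := by
    intro r hr
    have : (u.count false : ℝ) < r.count false := by exact_mod_cast count_false_lt hr
    linarith
  have hright : ∀ p, u ++ [false] <+: p → p <+: w →
      (p.count true : ℝ) - (u.count true + 1) ≤ s * (p.count false - u.count false) := by
    intro p hp hp'
    exact (div_le_iff₀ (hpos p hp)).1 (hmax p ⟨hp, hp'⟩)
  have hsD : s * (r₀.count false - u.count false) = (r₀.count true : ℝ) - (u.count true + 1) :=
    div_mul_cancel₀ _ (hpos r₀ hr₀).ne'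
  have hvert : vertices w ⊆ {z : ℝ × ℝ | z.2 - ((u.count true : ℝ) + 1) < s * (z.1 - u.count false) ∨
      (z.2 - ((u.count true : ℝ) + 1) = s * (z.1 - u.count false) ∧ (u.count false : ℝ) < z.1)} := by
    rintro _ ⟨p, hp, rfl⟩
    have hcase : u ++ [false] <+: p ∨ p <+: u := by
      rcases List.prefix_or_prefix_of_prefix hp hu with h | h
      · rcases List.prefix_concat_iff.1 h with rfl | h
        · exact Or.inl List.prefix_rfl
        · exact Or.inr h
      · exact Or.inl h
    rcases hcase with h | h
    · rcases (hright p h hp).lt_or_eq with h1 | h1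
      · exact Or.inl h1
      · exact Or.inr ⟨h1, sub_pos.1 (hpos p h)⟩
    · left
      have h1 := hw p u r₀ h hr₀ hr₀'
      have h2 : ((u.count false : ℝ) - p.count false) * r₀.count true
        + ((r₀.count false : ℝ) - u.count false) * p.count true
        < ((r₀.count false : ℝ) - p.count false) * (u.count true + 1) := by exact_mod_cast h1
      show (p.count true : ℝ) - (u.count true + 1) < s * (p.count false - u.count false)
      refine lt_of_mul_lt_mul_right (a := (r₀.count false : ℝ) - u.count false) ?_ (hpos r₀ hr₀).le
      rw [mul_right_comm, hsD]
      nlinarith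
  have hmem := convexHull_min hvert (convex_lex_halfPlane s _ _)
    (hsub (show (((u.count false : ℤ) : ℝ), (j : ℝ) + 1) ∈ cell _ j by simp [cell]))
  have hj' : (u.count true : ℝ) ≤ j := by exact_mod_cast hj
  rcases hmem with h | ⟨-, h⟩
  · simp at h
    linarith
  · simp at h

/-- If a chord passes at least one unit above the start of an east step, the cell resting on that
step is in the hull. The chord is nondecreasing, so both vertical sides of the cell lie between the
path and the chord; horizontal segments fill the rest. -/
theorem nearlyConcave_of_not_cell_subset {w : List Bool}
    (hw : ∀ i j : ℤ, CellAbove w i j → ¬ cell i j ⊆ convexHull ℝ (vertices w)) :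
    NearlyConcave w := by
  intro p q r hp hq hr
  by_contra hcon
  have hqw := hq.trans hr
  refine hw (q.count false) (q.count true) ⟨q, hqw, rfl, le_rfl⟩ ?_
  have hC := convex_convexHull ℝ (vertices w)
  have hV : ∀ t, t <+: w → ((t.count false : ℝ), (t.count true : ℝ)) ∈ convexHull ℝ (vertices w) :=
    fun t ht => subset_convexHull _ _ ⟨t, ht, rfl⟩
  have hq0 := (List.prefix_append q [false]).trans hqw
  have mp := hV p (hp.trans hq0)
  have mq := hV q hq0
  have mq' := hV _ hqw
  have mr := hV r hr
  simp at mq'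
  have h1 : (p.count false : ℝ) ≤ q.count false := by exact_mod_cast hp.sublist.count_le false
  have h2 : (q.count false : ℝ) + 1 ≤ r.count false := by exact_mod_cast count_false_lt hq
  have h3 : (p.count true : ℝ) ≤ q.count true := by exact_mod_cast hp.sublist.count_le true
  have h4 : ((r.count false : ℝ) - p.count false) * (q.count true + 1) ≤
      ((q.count false : ℝ) - p.count false) * r.count true
        + ((r.count false : ℝ) - q.count false) * p.count true := by
    have := not_lt.1 hcon
    exact_mod_cast this
  generalize (p.count false : ℝ) = x₁ at *
  generalize (p.count true : ℝ) = y₁ at *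
  generalize hx : (q.count false : ℝ) = x₂ at *
  generalize hy : (q.count true : ℝ) = y₂ at *
  generalize (r.count false : ℝ) = x₃ at *
  generalize (r.count true : ℝ) = y₃ at *
  have h13 : x₁ < x₃ := by linarith
  have h31 : 0 < x₃ - x₁ := by linarith
  have hle : y₁ ≤ y₃ := by
    by_contra h
    nlinarith
  have c1 := mem_of_chord hC mp mr h1 (by linarith) h13
  have c2 := mem_of_chord hC mp mr (by linarith : x₁ ≤ x₂ + 1) h2 h13
  rintro ⟨x, y⟩ ⟨⟨hxl, hxr⟩, hyl, hyr⟩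
  simp only [Int.cast_natCast, hx, hy] at hxl hxr hyl hyr
  refine mem_of_horizontal hC (mem_of_vertical hC mq c1 hyl (hyr.trans ?_))
    (mem_of_vertical hC mq' c2 hyl (hyr.trans ?_)) hxl hxr
  · rw [le_div_iff₀ h31]; linarith
  · rw [le_div_iff₀ h31]; nlinarith

theorem isNWConvex_cons_true_iff (w : List Bool) :
    IsNWConvex (true :: w) ↔ NearlyConcave w ∧ (w = [] ∨ w.getLast? = some true) := by
  have hlast : (true :: w).getLast? = some true ↔ w = [] ∨ w.getLast? = some true := by
    rcases List.eq_nil_or_concat w with rfl | ⟨t, c, rfl⟩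
    · simp
    · rw [List.concat_eq_append, ← List.cons_append, List.getLast?_concat, List.getLast?_concat]
      simp
  constructor
  · rintro ⟨-, h2, h3⟩
    exact ⟨NearlyConcave.of_append (u := [true]) (nearlyConcave_of_not_cell_subset h3), hlast.1 h2⟩
  · rintro ⟨h1, h2⟩
    exact ⟨rfl, hlast.2 h2, h1.cons_true.not_cell_subset⟩

end NWPath

namespace NWPath

/-! ### Counting multisets of directions -/

/-- The length of the part of a path below a direction. -/
def dirSize (v : Dir) : ℕ := v.1.1 + v.1.2

theorem dirSize_pos (v : Dir) : 0 < dirSize v := Nat.add_pos_right _ v.2.2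

/-- The total length of a multiset of directions. -/
def weight (M : Multiset Dir) : ℕ := (M.map dirSize).sum

theorem weight_add (M N : Multiset Dir) : weight (M + N) = weight M + weight N := by
  simp [weight]

theorem weight_replicate (j : ℕ) (v : Dir) :
    weight (Multiset.replicate j v) = j * dirSize v := by
  simp [weight]

/-- The word of a multiset of directions. -/
noncomputable def wordOfMultiset (M : Multiset Dir) : List Bool := wordOf (M.sort steeper)

theorem length_wordOfMultiset (M : Multiset Dir) : (wordOfMultiset M).length = weight M := by
  rw [wordOfMultiset, length_wordOf, weight]
  conv_rhs => rw [← Multiset.sort_eq M steeper]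
  rw [Multiset.map_coe, Multiset.sum_coe]
  rfl

theorem wordOfMultiset_injective : Function.Injective wordOfMultiset := by
  intro M N h
  rw [← Multiset.sort_eq M steeper, ← Multiset.sort_eq N steeper,
    wordOf_injective (Multiset.pairwise_sort M steeper) (Multiset.pairwise_sort N steeper) h]

theorem isNWConvex_cons_true_iff_exists (w : List Bool) :
    IsNWConvex (true :: w) ↔ ∃ M, wordOfMultiset M = w := by
  rw [isNWConvex_cons_true_iff]
  constructor
  · rintro ⟨h1, h2⟩
    obtain ⟨l, hl, rfl⟩ := exists_wordOf_eq w h1 h2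
    refine ⟨l, ?_⟩
    rw [wordOfMultiset]
    congr 1
    exact List.Perm.eq_of_pairwise' (Multiset.pairwise_sort _ _) hl
      (Multiset.coe_eq_coe.1 (Multiset.sort_eq _ _))
  · rintro ⟨M, rfl⟩
    exact ⟨nearlyConcave_wordOf _ (Multiset.pairwise_sort M steeper), wordOf_getLast? _⟩

theorem initialSteps_wordOfMultiset (M : Multiset Dir) :
    initialSteps (wordOfMultiset M) = M.count north := by
  rw [wordOfMultiset, initialSteps_wordOf _ (Multiset.pairwise_sort M steeper)]
  conv_rhs => rw [← Multiset.sort_eq M steeper]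
  rw [Multiset.coe_count]
  exact List.countP_congr fun v _ => by simp [Subtype.ext_iff]

theorem finite_weight_eq (n : ℕ) : {M : Multiset Dir | weight M = n}.Finite := by
  refine Set.Finite.of_finite_image (f := wordOfMultiset) ?_ wordOfMultiset_injective.injOn
  refine (List.finite_length_eq Bool n).subset ?_
  rintro _ ⟨M, hM, rfl⟩
  exact (length_wordOfMultiset M).trans hM

/-- The multisets of directions of total length `n`. -/
noncomputable def dirMultisets (n : ℕ) : Finset (Multiset Dir) := (finite_weight_eq n).toFinset

theorem mem_dirMultisets {n : ℕ} {M : Multiset Dir} : M ∈ dirMultisets n ↔ weight M = n := by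
  simp [dirMultisets]

theorem mem_reducedPaths {n : ℕ} {w : List Bool} :
    w ∈ reducedPaths n ↔ w.length = n ∧ IsNWConvex (true :: w) := by
  simp [reducedPaths]

theorem reducedPaths_eq_map (n : ℕ) :
    reducedPaths n = (dirMultisets n).map ⟨wordOfMultiset, wordOfMultiset_injective⟩ := by
  ext w
  rw [mem_reducedPaths, isNWConvex_cons_true_iff_exists, Finset.mem_map]
  constructor
  · rintro ⟨h, M, rfl⟩
    exact ⟨M, mem_dirMultisets.2 ((length_wordOfMultiset M).symm.trans h), rfl⟩
  · rintro ⟨M, hM, rfl⟩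
    exact ⟨(length_wordOfMultiset M).trans (mem_dirMultisets.1 hM), M, rfl⟩

/-- The number of reduced paths of length `n`. -/
noncomputable def pathCount (n : ℕ) : ℕ := (dirMultisets n).card

theorem card_reducedPaths (n : ℕ) : (reducedPaths n).card = pathCount n := by
  rw [reducedPaths_eq_map, Finset.card_map, pathCount]

theorem pathCount_pos (n : ℕ) : 0 < pathCount n := by
  refine Finset.card_pos.2 ⟨Multiset.replicate n north, ?_⟩
  rw [mem_dirMultisets, weight_replicate]
  simp [dirSize, north]

theorem pathCount_zero : pathCount 0 = 1 := by
  refine Finset.card_eq_one.2 ⟨0, ?_⟩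
  ext M
  rw [mem_dirMultisets, Finset.mem_singleton]
  constructor
  · intro h
    by_contra hM
    obtain ⟨v, hv⟩ := Multiset.exists_mem_of_ne_zero hM
    obtain ⟨N, rfl⟩ := Multiset.exists_cons_of_mem hv
    rw [weight, Multiset.map_cons, Multiset.sum_cons] at h
    have := dirSize_pos v
    omega
  · rintro rfl
    rfl

theorem replicate_add_of_le_count {M : Multiset Dir} {v : Dir} {j : ℕ} (h : j ≤ M.count v) :
    ∃ N, M = Multiset.replicate j v + N :=
  Multiset.le_iff_exists_add.1 (Multiset.le_count_iff_replicate_le.1 h)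

theorem card_filter_le_count (n j : ℕ) (v : Dir) :
    ((dirMultisets n).filter fun M => j ≤ M.count v).card =
      if j * dirSize v ≤ n then pathCount (n - j * dirSize v) else 0 := by
  split_ifs with h
  · rw [pathCount]
    symm
    refine Finset.card_bij (fun N _ => Multiset.replicate j v + N) ?_ ?_ ?_
    · intro N hN
      rw [mem_dirMultisets] at hN
      rw [Finset.mem_filter, mem_dirMultisets, weight_add, weight_replicate, hN,
        Multiset.count_add, Multiset.count_replicate_self]
      omega
    · intro N _ N' _ h
      exact add_left_cancel h
    · intro M hM
      rw [Finset.mem_filter, mem_dirMultisets] at hM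
      obtain ⟨N, rfl⟩ := replicate_add_of_le_count hM.2
      refine ⟨N, ?_, rfl⟩
      rw [mem_dirMultisets, ← hM.1, weight_add, weight_replicate]
      omega
  · rw [Finset.card_eq_zero, Finset.filter_eq_empty_iff]
    intro M hM hj
    obtain ⟨N, rfl⟩ := replicate_add_of_le_count hj
    rw [mem_dirMultisets, weight_add, weight_replicate] at hM
    omega

theorem count_mul_le_weight (M : Multiset Dir) (v : Dir) : M.count v * dirSize v ≤ weight M := by
  obtain ⟨N, hN⟩ := replicate_add_of_le_count (le_refl (M.count v))
  conv_rhs => rw [hN]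
  rw [weight_add, weight_replicate]
  omega

/-- A multiplicity is the number of j ≥ 1 not exceeding it, so the sum counts pairs (j, M) with j ≤
`M.count v`. -/
theorem sum_count (n : ℕ) (v : Dir) :
    ∑ M ∈ dirMultisets n, M.count v =
      ∑ j ∈ Finset.Icc 1 n, if j * dirSize v ≤ n then pathCount (n - j * dirSize v) else 0 := by
  simp_rw [← card_filter_le_count, Finset.card_filter]
  rw [Finset.sum_comm]
  refine Finset.sum_congr rfl fun M hM => ?_
  rw [mem_dirMultisets] at hM
  have h1 := count_mul_le_weight M v
  have h2 := dirSize_pos v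
  have h3 : M.count v ≤ n := by nlinarith
  rw [← Finset.card_filter]
  have : (Finset.Icc 1 n).filter (fun j => j ≤ M.count v) = Finset.Icc 1 (M.count v) := by
    ext j
    simp
    omega
  rw [this, Nat.card_Icc]
  omega

/-- The directions of size at most `n`. -/
def dirsUpTo (n : ℕ) : Finset Dir :=
  ((Finset.range (n + 1) ×ˢ Finset.range (n + 1)).subtype
    fun v : ℕ × ℕ => Nat.Coprime v.1 v.2 ∧ 0 < v.2).filter fun v => dirSize v ≤ n

theorem mem_dirsUpTo {n : ℕ} {v : Dir} : v ∈ dirsUpTo n ↔ dirSize v ≤ n := by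
  obtain ⟨⟨a, b⟩, h⟩ := v
  rw [dirsUpTo, Finset.mem_filter, Finset.mem_subtype, Finset.mem_product, Finset.mem_range,
    Finset.mem_range]
  simp only [dirSize]
  omega

/-- The vector (a, d - a) is primitive with positive height exactly when a < d and a is prime to d.
-/
theorem card_dirs_of_size {n d : ℕ} (h : d ≤ n) :
    ((dirsUpTo n).filter fun v => dirSize v = d).card = d.totient := by
  rw [Nat.totient_eq_card_coprime]
  refine Finset.card_bij (fun v _ => v.1.1) ?_ ?_ ?_
  · rintro ⟨⟨a, b⟩, hab, hb⟩ hv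
    rw [Finset.mem_filter] at hv
    obtain rfl := hv.2
    dsimp only at hb hab
    rw [Finset.mem_filter, Finset.mem_range]
    simp only [dirSize]
    exact ⟨by omega, by simpa using hab.symm⟩
  · rintro ⟨⟨a, b⟩, hab, hb⟩ hv ⟨⟨a', b'⟩, hab', hb'⟩ hv' e
    rw [Finset.mem_filter] at hv hv'
    have := hv.2.trans hv'.2.symm
    simp only [dirSize] at this e
    subst e
    obtain rfl : b = b' := by omega
    rfl
  · intro a ha
    rw [Finset.mem_filter, Finset.mem_range] at ha
    obtain ⟨b, rfl⟩ := Nat.exists_eq_add_of_le ha.1.le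
    have hcop : Nat.Coprime a b := by
      have := ha.2.symm
      simpa using this
    refine ⟨⟨(a, b), hcop, by omega⟩, ?_, rfl⟩
    rw [Finset.mem_filter, mem_dirsUpTo]
    exact ⟨h, rfl⟩

theorem weight_eq_sum {n : ℕ} {M : Multiset Dir} (h : weight M ≤ n) :
    weight M = ∑ v ∈ dirsUpTo n, dirSize v * M.count v := by
  rw [weight, Finset.sum_multiset_map_count]
  simp only [smul_eq_mul]
  refine (Finset.sum_subset ?_ ?_).trans (Finset.sum_congr rfl fun v _ => mul_comm _ _)
  · intro v hv
    rw [Multiset.mem_toFinset] at hv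
    rw [mem_dirsUpTo]
    have h1 := count_mul_le_weight M v
    have h2 := Multiset.one_le_count_iff_mem.2 hv
    nlinarith
  · intro v _ hv
    rw [Multiset.mem_toFinset] at hv
    rw [Multiset.count_eq_zero_of_notMem hv, zero_mul]

/-- The coefficients of the logarithmic derivative of the generating function of paths. -/
def totientSum (k : ℕ) : ℕ := ∑ d ∈ k.divisors, d * d.totient

/-- The total weight of all multisets is counted twice: as n times their number, and as a sum over
directions of size d and copy indices j, grouped by k = d j. -/
theorem mul_pathCount (n : ℕ) :
    n * pathCount n = ∑ k ∈ Finset.Icc 1 n, totientSum k * pathCount (n - k) := by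
  calc n * pathCount n = ∑ M ∈ dirMultisets n, weight M := by
        rw [Finset.sum_congr rfl fun M hM => mem_dirMultisets.1 hM, Finset.sum_const, pathCount,
          smul_eq_mul, mul_comm]
    _ = ∑ v ∈ dirsUpTo n, dirSize v * ∑ j ∈ Finset.Icc 1 n,
          if j * dirSize v ≤ n then pathCount (n - j * dirSize v) else 0 := by
        rw [Finset.sum_congr rfl fun M hM => weight_eq_sum (mem_dirMultisets.1 hM).le,
          Finset.sum_comm]
        simp_rw [← Finset.mul_sum, sum_count]
    _ = ∑ d ∈ Finset.Icc 1 n, d.totient * (d * ∑ j ∈ Finset.Icc 1 n,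
          if j * d ≤ n then pathCount (n - j * d) else 0) := by
        rw [← Finset.sum_fiberwise_of_maps_to (s := dirsUpTo n) (t := Finset.Icc 1 n)
          (g := dirSize) (fun v hv => Finset.mem_Icc.2 ⟨dirSize_pos v, mem_dirsUpTo.1 hv⟩)]
        refine Finset.sum_congr rfl fun d hd => ?_
        rw [← card_dirs_of_size (Finset.mem_Icc.1 hd).2, ← smul_eq_mul, ← Finset.sum_const]
        refine Finset.sum_congr rfl fun v hv => ?_
        rw [(Finset.mem_filter.1 hv).2]
    _ = ∑ d ∈ Finset.Icc 1 n, ∑ j ∈ Finset.Icc 1 n, ∑ k ∈ Finset.Icc 1 n,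
          if d * j = k then d * d.totient * pathCount (n - k) else 0 := by
        refine Finset.sum_congr rfl fun d hd => ?_
        rw [← mul_assoc, Finset.mul_sum]
        refine Finset.sum_congr rfl fun j hj => ?_
        rw [Finset.sum_ite_eq]
        have h1 : 0 < d * j := Nat.mul_pos (Finset.mem_Icc.1 hd).1 (Finset.mem_Icc.1 hj).1
        simp only [Finset.mem_Icc, mul_comm j d]
        by_cases h : d * j ≤ n
        · rw [if_pos h, if_pos ⟨h1, h⟩]
          ring
        · rw [if_neg h, if_neg (fun h' => h h'.2), mul_zero]
    _ = ∑ k ∈ Finset.Icc 1 n, ∑ x ∈ Finset.Icc 1 n ×ˢ Finset.Icc 1 n,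
          if x.1 * x.2 = k then x.1 * x.1.totient * pathCount (n - k) else 0 := by
        rw [Finset.sum_comm, ← Finset.sum_product', Finset.sum_comm]
        simp_rw [Finset.sum_product]
        refine Finset.sum_congr rfl fun k _ => ?_
        rw [Finset.sum_comm]
    _ = _ := by
        refine Finset.sum_congr rfl fun k hk => ?_
        rw [Finset.mem_Icc] at hk
        have h := Nat.sum_divisorsAntidiagonal (fun d _ => d * d.totient) (n := k)
        rw [← Finset.sum_filter, totientSum, ← h, Finset.sum_mul]
        refine Finset.sum_congr ?_ fun _ _ => rfl
        ext ⟨d, j⟩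
        simp only [Finset.mem_filter, Finset.mem_product, Finset.mem_Icc,
          Nat.mem_divisorsAntidiagonal]
        constructor
        · rintro ⟨-, rfl⟩
          exact ⟨rfl, by omega⟩
        · rintro ⟨rfl, h0⟩
          obtain ⟨hd, hj⟩ := Nat.mul_ne_zero_iff.1 h0
          refine ⟨⟨⟨by omega, ?_⟩, by omega, ?_⟩, rfl⟩
          · exact (Nat.le_mul_of_pos_right d (by omega)).trans hk.2
          · exact (Nat.le_mul_of_pos_left j (by omega)).trans hk.2

/-- The total number of initial vertical steps of the reduced paths of length `n`. -/
noncomputable def totalSteps (n : ℕ) : ℕ := ∑ j ∈ Finset.range n, pathCount j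

theorem sum_initialSteps_reducedPaths (n : ℕ) :
    ∑ w ∈ reducedPaths n, initialSteps w = totalSteps n := by
  rw [reducedPaths_eq_map, Finset.sum_map]
  simp only [Function.Embedding.coeFn_mk, initialSteps_wordOfMultiset]
  have hn : dirSize north = 1 := rfl
  rw [sum_count, totalSteps]
  simp only [hn, mul_one]
  refine Finset.sum_nbij' (fun j => n - j) (fun j => n - j) ?_ ?_ ?_ ?_ ?_
  · intro j hj
    rw [Finset.mem_Icc] at hj
    rw [Finset.mem_range]
    omega
  · intro j hj
    rw [Finset.mem_range] at hj
    rw [Finset.mem_Icc]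
    omega
  · intro j hj
    rw [Finset.mem_Icc] at hj
    exact Nat.sub_sub_self hj.2
  · intro j hj
    rw [Finset.mem_range] at hj
    exact Nat.sub_sub_self hj.le
  · intro j hj
    rw [if_pos (Finset.mem_Icc.1 hj).2]

theorem meanInitialSteps_reducedPaths (n : ℕ) :
    meanInitialSteps (reducedPaths n) = (totalSteps n : ℝ) / pathCount n := by
  rw [meanInitialSteps, card_reducedPaths, ← sum_initialSteps_reducedPaths]
  push_cast
  rfl

theorem paths_succ (n : ℕ) :
    paths (n + 1) = (reducedPaths n).map ⟨List.cons true, List.cons_injective⟩ := by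
  ext w
  simp only [paths, Set.Finite.mem_toFinset, Finset.mem_map, mem_reducedPaths,
    Function.Embedding.coeFn_mk]
  constructor
  · rintro ⟨h1, h2⟩
    obtain ⟨t, rfl⟩ : ∃ t, w = true :: t := by
      have := h2.begins_north
      cases w with
      | nil => simp at this
      | cons c t => exact ⟨t, by simp at this; rw [this]⟩
    exact ⟨t, ⟨by simpa using h1, h2⟩, rfl⟩
  · rintro ⟨t, ⟨h1, h2⟩, rfl⟩
    exact ⟨by simpa using h1, h2⟩

theorem meanInitialSteps_paths_succ (n : ℕ) :
    meanInitialSteps (paths (n + 1)) = (totalSteps n : ℝ) / pathCount n + 1 := by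
  have h0 : (pathCount n : ℝ) ≠ 0 := by exact_mod_cast (pathCount_pos n).ne'
  rw [meanInitialSteps, paths_succ, Finset.card_map, Finset.sum_map, card_reducedPaths,
    ← sum_initialSteps_reducedPaths]
  have : ∀ w, initialSteps (true :: w) = initialSteps w + 1 := fun w => by simp [initialSteps]
  simp only [Function.Embedding.coeFn_mk, this]
  push_cast
  rw [Finset.sum_add_distrib, Finset.sum_const, card_reducedPaths, nsmul_eq_mul, mul_one, add_div,
    div_self h0]

end NWPath

namespace NWPath

/-! ### Generating functions with a given logarithmic derivative -/

theorem summable_ofReal_mul_pow {a : ℕ → ℝ} (ha : ∀ n, 0 ≤ a n)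
    (h : ∀ y : ℝ, 0 ≤ y → y < 1 → Summable fun n => a n * y ^ n) {z : ℂ} (hz : ‖z‖ < 1) :
    Summable fun n => ‖(a n : ℂ) * z ^ n‖ := by
  refine (h ‖z‖ (norm_nonneg z) hz).congr fun n => ?_
  rw [norm_mul, norm_pow, Complex.norm_real, Real.norm_of_nonneg (ha n)]

/-- Termwise differentiation by locally uniform convergence; the constant term drops out, whence the
index shift. -/
theorem hasDerivAt_powerSeries {a : ℕ → ℝ} (ha : ∀ n, 0 ≤ a n)
    (h : ∀ y : ℝ, 0 ≤ y → y < 1 → Summable fun n => a n * y ^ n) {z : ℂ} (hz : ‖z‖ < 1)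
    (hd : Summable fun n : ℕ => ((n + 1 : ℕ) : ℂ) * a (n + 1) * z ^ n) :
    HasDerivAt (fun w : ℂ => ∑' n, (a n : ℂ) * w ^ n)
      (∑' n : ℕ, ((n + 1 : ℕ) : ℂ) * a (n + 1) * z ^ n) z := by
  obtain ⟨r, hr, hr1⟩ := exists_between hz
  have h0 : 0 ≤ r := (norm_nonneg z).trans hr.le
  have hle : ∀ (i : ℕ) (w : ℂ), w ∈ Metric.ball (0 : ℂ) r → ‖(a i : ℂ) * w ^ i‖ ≤ a i * r ^ i := by
    intro i w hw
    rw [mem_ball_zero_iff] at hw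
    rw [norm_mul, norm_pow, Complex.norm_real, Real.norm_of_nonneg (ha i)]
    exact mul_le_mul_of_nonneg_left (pow_le_pow_left₀ (norm_nonneg w) hw.le i) (ha i)
  have hdiff : ∀ i : ℕ, DifferentiableOn ℂ (fun w : ℂ => (a i : ℂ) * w ^ i) (Metric.ball 0 r) :=
    fun i => by fun_prop
  have hzr : z ∈ Metric.ball (0 : ℂ) r := mem_ball_zero_iff.2 hr
  have h1 := Complex.hasSum_deriv_of_summable_norm (h r h0 hr1) hdiff Metric.isOpen_ball hle hzr
  have h2 := (Complex.differentiableOn_tsum_of_summable_norm (h r h0 hr1) hdiff Metric.isOpen_ball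
    hle).differentiableAt (Metric.isOpen_ball.mem_nhds hzr) |>.hasDerivAt
  suffices h5 : HasSum (fun i : ℕ => deriv (fun w : ℂ => (a i : ℂ) * w ^ i) z)
      (∑' n : ℕ, ((n + 1 : ℕ) : ℂ) * a (n + 1) * z ^ n) by
    rw [h5.unique h1]
    exact h2
  have h3 : ∀ i : ℕ, deriv (fun w : ℂ => (a i : ℂ) * w ^ i) z = a i * (i * z ^ (i - 1)) := by
    intro i
    rw [deriv_const_mul_field, deriv_pow_field]
  simp_rw [h3]
  rw [← hasSum_nat_add_iff' 1]
  simp only [Finset.range_one, Finset.sum_singleton, Nat.cast_zero, zero_mul, mul_zero, sub_zero,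
    Nat.add_sub_cancel]
  refine hd.hasSum.congr_fun ?_
  intro n
  ring

/-- With L = Σ a_k y^k, the recurrence bounds n c_n y^n by L times a bound for the earlier terms.
Once n ≥ L this bound no longer grows, so the first N + 1 terms with N ≥ L suffice. -/
theorem exists_coeff_mul_pow_le {a c : ℕ → ℝ} (ha : ∀ n, 0 ≤ a n) (hc : ∀ n, 0 ≤ c n)
    (hsum : ∀ y : ℝ, 0 ≤ y → y < 1 → Summable fun n => a n * y ^ n)
    (hrec : ∀ n : ℕ, (n : ℝ) * c n = ∑ k ∈ Finset.Icc 1 n, a k * c (n - k))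
    {y : ℝ} (hy : 0 ≤ y) (hy1 : y < 1) : ∃ K, ∀ n, c n * y ^ n ≤ K := by
  set L := ∑' n, a n * y ^ n with hL
  obtain ⟨N, hN⟩ := exists_nat_ge L
  have hterm : ∀ n, 0 ≤ c n * y ^ n := fun n => mul_nonneg (hc n) (pow_nonneg hy n)
  refine ⟨∑ j ∈ Finset.range (N + 1), c j * y ^ j, fun n => ?_⟩
  set K := ∑ j ∈ Finset.range (N + 1), c j * y ^ j
  have hK : 0 ≤ K := Finset.sum_nonneg fun j _ => hterm j
  induction n using Nat.strong_induction_on with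
  | _ n ih =>
    rcases le_or_gt n N with h | h
    · exact Finset.single_le_sum (fun j _ => hterm j) (Finset.mem_range.2 (by omega))
    · have hn : (0 : ℝ) < n := by exact_mod_cast (by omega : 0 < n)
      have hNn : (N : ℝ) ≤ n := by exact_mod_cast h.le
      refine le_of_mul_le_mul_left ?_ hn
      calc (n : ℝ) * (c n * y ^ n) = ∑ k ∈ Finset.Icc 1 n, a k * y ^ k * (c (n - k) * y ^ (n - k)) := by
            rw [← mul_assoc, hrec, Finset.sum_mul]
            refine Finset.sum_congr rfl fun k hk => ?_
            have : y ^ n = y ^ k * y ^ (n - k) := by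
              rw [← pow_add, Nat.add_sub_cancel' (Finset.mem_Icc.1 hk).2]
            rw [this]
            ring
        _ ≤ ∑ k ∈ Finset.Icc 1 n, a k * y ^ k * K := by
            refine Finset.sum_le_sum fun k hk => ?_
            rw [Finset.mem_Icc] at hk
            exact mul_le_mul_of_nonneg_left (ih (n - k) (by omega))
              (mul_nonneg (ha k) (pow_nonneg hy k))
        _ ≤ L * K := by
            rw [← Finset.sum_mul]
            refine mul_le_mul_of_nonneg_right ?_ hK
            exact (hsum y hy hy1).sum_le_tsum _ fun k _ => mul_nonneg (ha k) (pow_nonneg hy k)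
        _ ≤ n * K := mul_le_mul_of_nonneg_right (hN.trans hNn) hK

theorem summable_coeff_mul_pow {a c : ℕ → ℝ} (ha : ∀ n, 0 ≤ a n) (hc : ∀ n, 0 ≤ c n)
    (hsum : ∀ y : ℝ, 0 ≤ y → y < 1 → Summable fun n => a n * y ^ n)
    (hrec : ∀ n : ℕ, (n : ℝ) * c n = ∑ k ∈ Finset.Icc 1 n, a k * c (n - k))
    {y : ℝ} (hy : 0 ≤ y) (hy1 : y < 1) :
    Summable fun n => c n * y ^ n := by
  obtain ⟨r, hr, hr1⟩ := exists_between hy1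
  have hr0 : 0 < r := hy.trans_lt hr
  obtain ⟨K, hK⟩ := exists_coeff_mul_pow_le ha hc hsum hrec hr0.le hr1
  refine Summable.of_nonneg_of_le (fun n => mul_nonneg (hc n) (pow_nonneg hy n)) (fun n => ?_)
    ((summable_geometric_of_lt_one (div_nonneg hy hr0.le) ((div_lt_one hr0).2 hr)).mul_left K)
  rw [div_pow, ← mul_div_assoc, le_div_iff₀ (pow_pos hr0 n), mul_right_comm]
  exact mul_le_mul_of_nonneg_right (hK n) (pow_nonneg hy n)

/-- Let B be the exponent and C the series. The recurrence says C' = B' C, so e^{-B} C has zero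
derivative on the unit disc, and it equals 1 at 0. The term of index 0 of B vanishes because `a 0 /
0 = 0`. -/
theorem tsum_coeff_mul_pow {a c : ℕ → ℝ} (ha : ∀ n, 0 ≤ a n) (hc : ∀ n, 0 ≤ c n)
    (hsum : ∀ y : ℝ, 0 ≤ y → y < 1 → Summable fun n => a n * y ^ n)
    (hrec : ∀ n : ℕ, (n : ℝ) * c n = ∑ k ∈ Finset.Icc 1 n, a k * c (n - k))
    (hc0 : c 0 = 1) {z : ℂ} (hz : ‖z‖ < 1) :
    ∑' n, (c n : ℂ) * z ^ n = Complex.exp (∑' n : ℕ, ((a n / n : ℝ) : ℂ) * z ^ n) := by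
  have hcs := fun y (hy : 0 ≤ y) => summable_coeff_mul_pow ha hc hsum hrec hy
  have hb : ∀ n : ℕ, 0 ≤ a n / n := fun n => div_nonneg (ha n) n.cast_nonneg
  have hbs : ∀ y : ℝ, 0 ≤ y → y < 1 → Summable fun n : ℕ => a n / n * y ^ n := by
    intro y hy hy1
    refine Summable.of_nonneg_of_le (fun n => mul_nonneg (hb n) (pow_nonneg hy n)) (fun n => ?_)
      (hsum y hy hy1)
    refine mul_le_mul_of_nonneg_right ?_ (pow_nonneg hy n)
    rcases Nat.eq_zero_or_pos n with rfl | hn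
    · simpa using ha 0
    · exact div_le_self (ha n) (by exact_mod_cast hn)
  have hshift : ∀ y : ℝ, 0 ≤ y → y < 1 → Summable fun n : ℕ => a (n + 1) * y ^ n := by
    intro y hy hy1
    rcases hy.eq_or_lt with rfl | hy0
    · exact summable_of_ne_finset_zero (s := {0}) fun n hn => by
        simp at hn
        simp [hn]
    · have := (summable_nat_add_iff 1).2 (hsum y hy hy1)
      refine (this.mul_right y⁻¹).congr fun n => ?_
      rw [pow_succ, mul_assoc, mul_assoc, mul_inv_cancel₀ hy0.ne', mul_one]
  set A : ℂ → ℂ := fun z => ∑' n, ((a (n + 1) : ℝ) : ℂ) * z ^ n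
  have hBd : ∀ z : ℂ, ‖z‖ < 1 →
      HasDerivAt (fun w : ℂ => ∑' n : ℕ, ((a n / n : ℝ) : ℂ) * w ^ n) (A z) z := by
    intro z hz
    have e : ∀ n : ℕ, ((n + 1 : ℕ) : ℂ) * ((a (n + 1) / ((n + 1 : ℕ) : ℝ) : ℝ) : ℂ) * z ^ n
        = (a (n + 1) : ℂ) * z ^ n := by
      intro n
      have : ((n + 1 : ℕ) : ℂ) ≠ 0 := by exact_mod_cast n.succ_ne_zero
      push_cast at this ⊢
      field_simp
    have hs := (summable_ofReal_mul_pow (fun n => ha (n + 1)) hshift hz).of_norm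
    have h1 := hasDerivAt_powerSeries hb hbs hz (hs.congr fun n => (e n).symm)
    rwa [tsum_congr e] at h1
  have hCd : ∀ z : ℂ, ‖z‖ < 1 →
      HasDerivAt (fun w : ℂ => ∑' n : ℕ, (c n : ℂ) * w ^ n) (A z * ∑' n, (c n : ℂ) * z ^ n) z := by
    intro z hz
    have hs1 := summable_ofReal_mul_pow (fun n => ha (n + 1)) hshift hz
    have hs2 := summable_ofReal_mul_pow hc hcs hz
    have e : ∀ n : ℕ, ((n + 1 : ℕ) : ℂ) * c (n + 1) * z ^ n
        = ∑ kl ∈ Finset.HasAntidiagonal.antidiagonal n, ((a (kl.1 + 1) : ℂ) * z ^ kl.1) * ((c kl.2 : ℂ) * z ^ kl.2) := by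
      intro n
      have h1 := hrec (n + 1)
      have h2 : ∑ k ∈ Finset.Icc 1 (n + 1), a k * c (n + 1 - k)
          = ∑ kl ∈ Finset.HasAntidiagonal.antidiagonal n, a (kl.1 + 1) * c kl.2 := by
        rw [Finset.Nat.sum_antidiagonal_eq_sum_range_succ (fun k l => a (k + 1) * c l)]
        refine Finset.sum_nbij' (fun k => k - 1) (fun k => k + 1) ?_ ?_ ?_ ?_ ?_
        · intro k hk
          rw [Finset.mem_Icc] at hk
          rw [Finset.mem_range]
          omega
        · intro k hk
          rw [Finset.mem_range] at hk
          rw [Finset.mem_Icc]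
          omega
        · intro k hk
          exact Nat.sub_add_cancel (Finset.mem_Icc.1 hk).1
        · intro k _
          rfl
        · intro k hk
          rw [Finset.mem_Icc] at hk
          rw [Nat.sub_add_cancel hk.1]
          congr 2
          omega
      have h3 := congrArg (fun x : ℝ => (x : ℂ) * z ^ n) (h1.trans h2)
      push_cast at h3 ⊢
      rw [h3, Finset.sum_mul]
      refine Finset.sum_congr rfl fun kl hkl => ?_
      rw [← Finset.HasAntidiagonal.mem_antidiagonal.1 hkl, pow_add]
      ring
    have hs3 := (summable_norm_sum_mul_antidiagonal_of_summable_norm hs1 hs2).of_norm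
    have h1 := hasDerivAt_powerSeries hc hcs hz (hs3.congr fun n => (e n).symm)
    rwa [tsum_congr e, ← tsum_mul_tsum_eq_tsum_sum_antidiagonal_of_summable_norm hs1 hs2] at h1
  set B : ℂ → ℂ := fun w : ℂ => ∑' n : ℕ, ((a n / n : ℝ) : ℂ) * w ^ n
  set C : ℂ → ℂ := fun w : ℂ => ∑' n : ℕ, (c n : ℂ) * w ^ n
  have hE : ∀ z : ℂ, ‖z‖ < 1 → HasDerivAt (fun w => Complex.exp (-B w) * C w) 0 z := by
    intro z hz
    refine ((hBd z hz).neg.cexp.mul (hCd z hz)).congr_deriv ?_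
    simp only [Pi.neg_apply]
    ring
  have hconst := Metric.isOpen_ball.is_const_of_deriv_eq_zero (s := Metric.ball (0 : ℂ) 1)
    (convex_ball (0 : ℂ) 1).isPreconnected
    (fun w hw => (hE w (mem_ball_zero_iff.1 hw)).differentiableAt.differentiableWithinAt)
    (fun w hw => (hE w (mem_ball_zero_iff.1 hw)).deriv) (mem_ball_zero_iff.2 hz)
    (Metric.mem_ball_self one_pos)
  have hB0 : B 0 = 0 := by
    simp only [B]
    rw [tsum_eq_single 0 (fun n hn => by simp [hn])]
    simp
  have hC0 : C 0 = 1 := by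
    simp only [C]
    rw [tsum_eq_single 0 (fun n hn => by simp [hn])]
    simp [hc0]
  simp only [hB0, hC0, neg_zero, Complex.exp_zero, mul_one] at hconst
  rw [Complex.exp_neg, inv_mul_eq_div, div_eq_one_iff_eq (Complex.exp_ne_zero _)] at hconst
  exact hconst

end NWPath

namespace NWPath

/-! ### Coefficients as integrals -/

theorem integral_cexp_int_mul (k : ℤ) (t : ℝ) :
    ∫ θ in (-Real.pi)..Real.pi, Complex.exp (k * (-t + θ * Complex.I)) =
      if k = 0 then (2 * Real.pi : ℂ) else 0 := by
  split_ifs with hk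
  · simp [hk]
    ring
  · have hk' : (k : ℂ) ≠ 0 := by exact_mod_cast hk
    have h1 : ∀ θ : ℝ, Complex.exp (k * (-t + θ * Complex.I)) =
        Complex.exp (-(k * t)) * Complex.exp (k * Complex.I * θ) := by
      intro θ
      rw [← Complex.exp_add]
      congr 1
      ring
    simp_rw [h1]
    rw [intervalIntegral.integral_const_mul,
      integral_exp_mul_complex (mul_ne_zero hk' Complex.I_ne_zero)]
    have h2 : Complex.exp (k * Complex.I * (Real.pi : ℝ)) =
        Complex.exp (k * Complex.I * ((-Real.pi : ℝ) : ℂ)) := by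
      rw [Complex.exp_eq_exp_iff_exists_int]
      exact ⟨k, by push_cast; ring⟩
    rw [h2, sub_self, zero_div, mul_zero]

/-- Cauchy's coefficient formula on the circle of radius e^{-t}, by termwise integration and
orthogonality of the exponentials. -/
theorem integral_powerSeries_mul_cexp {c : ℕ → ℝ} (hc : ∀ n, 0 ≤ c n) {t : ℝ}
    (hs : Summable fun n : ℕ => c n * Real.exp (-t) ^ n) (n : ℕ) :
    ∫ θ in (-Real.pi)..Real.pi, (∑' m : ℕ, (c m : ℂ) * Complex.exp (-t + θ * Complex.I) ^ m) *
      Complex.exp (-(n * (-t + θ * Complex.I))) = 2 * Real.pi * c n := by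
  have hnorm : ∀ (θ : ℝ) (m : ℕ), ‖(c m : ℂ) * Complex.exp (-t + θ * Complex.I) ^ m‖ =
      c m * Real.exp (-t) ^ m := by
    intro θ m
    rw [norm_mul, norm_pow, Complex.norm_real, Real.norm_of_nonneg (hc m), Complex.norm_exp]
    simp
  have h1 := intervalIntegral.hasSum_integral_of_dominated_convergence (a := -Real.pi)
    (b := Real.pi) (μ := MeasureTheory.volume)
    (F := fun (m : ℕ) (θ : ℝ) => (c m : ℂ) * Complex.exp (-t + θ * Complex.I) ^ m *
      Complex.exp (-(n * (-t + θ * Complex.I))))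
    (f := fun θ : ℝ => (∑' m : ℕ, (c m : ℂ) * Complex.exp (-t + θ * Complex.I) ^ m) *
      Complex.exp (-(n * (-t + θ * Complex.I))))
    (fun m _ => c m * Real.exp (-t) ^ m * Real.exp (n * t))
    (fun m => (by fun_prop : Continuous _).aestronglyMeasurable) ?_ ?_ ?_ ?_
  · have h2 : ∀ m : ℕ, ∫ θ in (-Real.pi)..Real.pi,
        (c m : ℂ) * Complex.exp (-t + θ * Complex.I) ^ m *
          Complex.exp (-(n * (-t + θ * Complex.I))) = if m = n then (2 * Real.pi * c n : ℂ) else 0 := by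
      intro m
      have h3 : ∀ θ : ℝ, (c m : ℂ) * Complex.exp (-t + θ * Complex.I) ^ m *
          Complex.exp (-(n * (-t + θ * Complex.I))) =
          c m * Complex.exp (((m - n : ℤ) : ℂ) * (-t + θ * Complex.I)) := by
        intro θ
        rw [← Complex.exp_nat_mul, mul_assoc, ← Complex.exp_add]
        congr 2
        push_cast
        ring
      simp_rw [h3]
      rw [intervalIntegral.integral_const_mul, integral_cexp_int_mul]
      by_cases h : m = n
      · subst h
        simp
        ring
      · rw [if_neg h, if_neg (by omega), mul_zero]
    simp_rw [h2] at h1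
    exact h1.unique (hasSum_ite_eq n _)
  · intro m
    refine Filter.Eventually.of_forall fun θ _ => ?_
    rw [norm_mul, hnorm, Complex.norm_exp]
    simp
  · refine Filter.Eventually.of_forall fun θ _ => ?_
    exact hs.mul_right _
  · exact intervalIntegrable_const
  · refine Filter.Eventually.of_forall fun θ _ => ?_
    refine HasSum.mul_right _ (Summable.hasSum ?_)
    refine Summable.of_norm ?_
    simp_rw [hnorm]
    exact hs

/-! ### The generating functions of paths -/

theorem totientSum_le (n : ℕ) : totientSum n ≤ n ^ 3 := by
  calc totientSum n ≤ ∑ d ∈ n.divisors, n * n := by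
        refine Finset.sum_le_sum fun d hd => ?_
        have := Nat.divisor_le hd
        exact Nat.mul_le_mul this ((Nat.totient_le d).trans this)
    _ ≤ n * (n * n) := by
        rw [Finset.sum_const, smul_eq_mul]
        exact Nat.mul_le_mul_right _ (Nat.card_divisors_le_self n)
    _ = n ^ 3 := by ring

theorem summable_totientSum_mul_pow {y : ℝ} (hy : 0 ≤ y) (hy1 : y < 1) (k : ℕ) :
    Summable fun n : ℕ => (n : ℝ) ^ k * totientSum n * y ^ n := by
  refine Summable.of_nonneg_of_le (fun n => by positivity) (fun n => ?_)
    (summable_pow_mul_geometric_of_norm_lt_one (k + 3) (by rwa [Real.norm_of_nonneg hy]))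
  rw [pow_add]
  have : (totientSum n : ℝ) ≤ (n : ℝ) ^ 3 := by exact_mod_cast totientSum_le n
  gcongr

/-- The logarithm of the generating function of paths. -/
noncomputable def logGenFun (z : ℂ) : ℂ := ∑' n : ℕ, ((totientSum n / n : ℝ) : ℂ) * z ^ n

theorem pathCount_recurrence (n : ℕ) :
    (n : ℝ) * pathCount n = ∑ k ∈ Finset.Icc 1 n, (totientSum k : ℝ) * pathCount (n - k) := by
  exact_mod_cast mul_pathCount n

theorem summable_pathCount_mul_pow {y : ℝ} (hy : 0 ≤ y) (hy1 : y < 1) :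
    Summable fun n => (pathCount n : ℝ) * y ^ n := by
  refine summable_coeff_mul_pow (a := fun n => (totientSum n : ℝ)) (fun n => by positivity)
    (fun n => by positivity) (fun y hy hy1 => ?_) pathCount_recurrence hy hy1
  simpa using summable_totientSum_mul_pow hy hy1 0

theorem tsum_pathCount_mul_pow {z : ℂ} (hz : ‖z‖ < 1) :
    ∑' n, ((pathCount n : ℝ) : ℂ) * z ^ n = Complex.exp (logGenFun z) := by
  refine tsum_coeff_mul_pow (a := fun n => (totientSum n : ℝ)) (fun n => by positivity)
    (fun n => by positivity) (fun y hy hy1 => ?_) pathCount_recurrence (by simp [pathCount_zero]) hz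
  simpa using summable_totientSum_mul_pow hy hy1 0

/-- Partial sums are a convolution with z + z² + ...; the index 0 is excluded because `totalSteps n`
stops at `n - 1`. -/
theorem totalSteps_mul_pow {R : Type*} [CommSemiring R] (z : R) (n : ℕ) :
    (totalSteps n : R) * z ^ n = ∑ kl ∈ Finset.HasAntidiagonal.antidiagonal n,
      (if kl.1 = 0 then 0 else z ^ kl.1) * ((pathCount kl.2 : R) * z ^ kl.2) := by
  rw [Finset.Nat.sum_antidiagonal_eq_sum_range_succ
    (fun k l => (if k = 0 then 0 else z ^ k) * ((pathCount l : R) * z ^ l)),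
    Finset.sum_range_succ', totalSteps, ← Finset.sum_range_reflect]
  push_cast
  rw [Finset.sum_mul, zero_mul, add_zero]
  refine Finset.sum_congr rfl fun k hk => ?_
  rw [Finset.mem_range] at hk
  rw [mul_left_comm, ← pow_add, Nat.add_sub_cancel' (by omega),
    Nat.sub_sub, add_comm 1 k]

theorem hasSum_pow_succ_geometric {z : ℂ} (hz : ‖z‖ < 1) :
    HasSum (fun k : ℕ => if k = 0 then 0 else z ^ k) (z / (1 - z)) := by
  rw [← hasSum_nat_add_iff' 1]
  simp only [Finset.range_one, Finset.sum_singleton, if_pos, sub_zero, Nat.add_eq_zero_iff,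
    one_ne_zero, and_false, if_false, pow_succ', div_eq_mul_inv]
  exact (hasSum_geometric_of_norm_lt_one hz).mul_left z

theorem summable_norm_pow_succ_geometric {z : ℂ} (hz : ‖z‖ < 1) :
    Summable (fun k : ℕ => ‖if k = 0 then 0 else z ^ k‖) := by
  refine Summable.of_nonneg_of_le (fun _ => norm_nonneg _) (fun k => ?_)
    (summable_geometric_of_lt_one (norm_nonneg z) hz)
  split_ifs
  · simp
  · rw [norm_pow]

theorem summable_totalSteps_mul_pow {z : ℂ} (hz : ‖z‖ < 1) :
    Summable fun n => ‖((totalSteps n : ℝ) : ℂ) * z ^ n‖ := by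
  have h := summable_norm_sum_mul_antidiagonal_of_summable_norm (summable_norm_pow_succ_geometric hz)
    (summable_ofReal_mul_pow (a := fun n => (pathCount n : ℝ)) (fun n => by positivity)
      (fun y hy hy1 => summable_pathCount_mul_pow hy hy1) hz)
  refine h.congr fun n => ?_
  simp only [Complex.ofReal_natCast]
  rw [totalSteps_mul_pow]

theorem tsum_totalSteps_mul_pow {z : ℂ} (hz : ‖z‖ < 1) :
    ∑' n, ((totalSteps n : ℝ) : ℂ) * z ^ n = z / (1 - z) * Complex.exp (logGenFun z) := by
  rw [← tsum_pathCount_mul_pow hz, ← (hasSum_pow_succ_geometric hz).tsum_eq,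
    tsum_mul_tsum_eq_tsum_sum_antidiagonal_of_summable_norm (summable_norm_pow_succ_geometric hz)
    (summable_ofReal_mul_pow (a := fun n => (pathCount n : ℝ)) (fun n => by positivity)
      (fun y hy hy1 => summable_pathCount_mul_pow hy hy1) hz)]
  simp only [Complex.ofReal_natCast]
  exact tsum_congr fun n => totalSteps_mul_pow z n

theorem norm_cexp_neg_add_mul_I (t θ : ℝ) : ‖Complex.exp (-t + θ * Complex.I)‖ = Real.exp (-t) := by
  rw [Complex.norm_exp]
  simp

theorem norm_cexp_lt_one {t : ℝ} (ht : 0 < t) (θ : ℝ) :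
    ‖Complex.exp (-t + θ * Complex.I)‖ < 1 := by
  rw [norm_cexp_neg_add_mul_I, Real.exp_lt_one_iff]
  linarith

theorem integral_pathCount {t : ℝ} (ht : 0 < t) (n : ℕ) :
    ∫ θ in (-Real.pi)..Real.pi, Complex.exp (logGenFun (Complex.exp (-t + θ * Complex.I))) *
      Complex.exp (-(n * (-t + θ * Complex.I))) = 2 * Real.pi * (pathCount n : ℝ) := by
  rw [← integral_powerSeries_mul_cexp (c := fun n => (pathCount n : ℝ)) (fun n => by positivity)
    (summable_pathCount_mul_pow (Real.exp_nonneg _) (Real.exp_lt_one_iff.2 (by linarith))) n]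
  simp_rw [tsum_pathCount_mul_pow (norm_cexp_lt_one ht _)]

theorem integral_totalSteps {t : ℝ} (ht : 0 < t) (n : ℕ) :
    ∫ θ in (-Real.pi)..Real.pi, Complex.exp (-t + θ * Complex.I) /
      (1 - Complex.exp (-t + θ * Complex.I)) *
      Complex.exp (logGenFun (Complex.exp (-t + θ * Complex.I))) *
      Complex.exp (-(n * (-t + θ * Complex.I))) = 2 * Real.pi * (totalSteps n : ℝ) := by
  have hs := summable_totalSteps_mul_pow (norm_cexp_lt_one ht 0)
  simp only [norm_mul, norm_pow, norm_cexp_neg_add_mul_I, Complex.norm_real,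
    Real.norm_of_nonneg (Nat.cast_nonneg _)] at hs
  rw [← integral_powerSeries_mul_cexp (c := fun n => (totalSteps n : ℝ)) (fun n => by positivity)
    hs n]
  simp_rw [tsum_totalSteps_mul_pow (norm_cexp_lt_one ht _)]

end NWPath

namespace NWPath

open scoped Topology ArithmeticFunction.Moebius

/-! ### Abelian asymptotics of Dirichlet convolutions -/

/-- The series `∑ f n e^{-n x}`. -/
noncomputable def expSeries (f : ℕ → ℝ) (x : ℝ) : ℝ := ∑' n : ℕ, f n * Real.exp (-(n * x))

/-- The Dirichlet convolution of two sequences. -/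
def dirichletConv (w f : ℕ → ℝ) (n : ℕ) : ℝ := ∑ p ∈ n.divisorsAntidiagonal, w p.1 * f p.2

theorem exp_neg_nat_mul (n : ℕ) (x : ℝ) : Real.exp (-(n * x)) = Real.exp (-x) ^ n := by
  rw [← Real.exp_nat_mul]
  congr 1
  ring

theorem summable_pow_mul_exp (p : ℕ) {x : ℝ} (hx : 0 < x) :
    Summable fun n : ℕ => (n : ℝ) ^ p * Real.exp (-(n * x)) := by
  simp_rw [exp_neg_nat_mul]
  refine summable_pow_mul_geometric_of_norm_lt_one p ?_
  rw [Real.norm_of_nonneg (Real.exp_nonneg _), Real.exp_lt_one_iff]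
  linarith

theorem summable_prod_mul_exp {w f : ℕ → ℝ} {p q : ℕ} (hw : ∀ k, |w k| ≤ (k : ℝ) ^ p)
    (hf : ∀ d, |f d| ≤ (d : ℝ) ^ q) (hw0 : w 0 = 0) (hf0 : f 0 = 0) {x : ℝ} (hx : 0 < x) :
    Summable fun kd : ℕ × ℕ => w kd.1 * f kd.2 * Real.exp (-((kd.1 * kd.2 : ℕ) * x)) := by
  have h := (summable_pow_mul_exp p (half_pos hx)).mul_of_nonneg
    (summable_pow_mul_exp q (half_pos hx)) (fun n => by positivity) (fun n => by positivity)
  refine Summable.of_norm_bounded h ?_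
  rintro ⟨k, d⟩
  dsimp only
  rcases Nat.eq_zero_or_pos k with rfl | hk
  · rw [hw0]
    simp only [zero_mul, norm_zero]
    positivity
  rcases Nat.eq_zero_or_pos d with rfl | hd
  · rw [hf0]
    simp only [mul_zero, zero_mul, norm_zero]
    positivity
  have hk' : (1 : ℝ) ≤ k := by exact_mod_cast hk
  have hd' : (1 : ℝ) ≤ d := by exact_mod_cast hd
  have hexp : Real.exp (-((k * d : ℕ) * x)) ≤
      Real.exp (-(k * (x / 2))) * Real.exp (-(d * (x / 2))) := by
    rw [← Real.exp_add, Real.exp_le_exp]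
    push_cast
    -- For k, d ≥ 1 this splits the exponential of the product into a product of two convergent
    -- series.
    have : (k : ℝ) + d ≤ 2 * (k * d) := by nlinarith
    nlinarith
  rw [norm_mul, norm_mul, Real.norm_eq_abs, Real.norm_eq_abs, Real.norm_of_nonneg (Real.exp_nonneg _)]
  calc |w k| * |f d| * Real.exp (-((k * d : ℕ) * x))
      ≤ (k : ℝ) ^ p * (d : ℝ) ^ q *
          (Real.exp (-(k * (x / 2))) * Real.exp (-(d * (x / 2)))) := by
        gcongr
        · exact hw k
        · exact hf d
    _ = _ := by ring

theorem expSeries_dirichletConv {w f : ℕ → ℝ} {p q : ℕ} (hw : ∀ k, |w k| ≤ (k : ℝ) ^ p)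
    (hf : ∀ d, |f d| ≤ (d : ℝ) ^ q) (hw0 : w 0 = 0) (hf0 : f 0 = 0) {x : ℝ} (hx : 0 < x) :
    expSeries (dirichletConv w f) x = ∑' k : ℕ, w k * expSeries f (k * x) := by
  have hS := summable_prod_mul_exp hw hf hw0 hf0 hx
  have h1 := hS.hasSum.tsum_fiberwise (fun kd : ℕ × ℕ => kd.1 * kd.2)
  have h2 : ∀ n : ℕ, ∑' b : (fun kd : ℕ × ℕ => kd.1 * kd.2) ⁻¹' {n},
      w b.1.1 * f b.1.2 * Real.exp (-((b.1.1 * b.1.2 : ℕ) * x)) =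
      dirichletConv w f n * Real.exp (-(n * x)) := by
    intro n
    have h3 : ∀ b : (fun kd : ℕ × ℕ => kd.1 * kd.2) ⁻¹' {n},
        w b.1.1 * f b.1.2 * Real.exp (-((b.1.1 * b.1.2 : ℕ) * x)) =
        w b.1.1 * f b.1.2 * Real.exp (-(n * x)) := by
      rintro ⟨⟨k, d⟩, hkd⟩
      have : k * d = n := hkd
      simp only [this]
    rw [tsum_congr h3, tsum_mul_right]
    congr 1
    -- The fibre of multiplication over 0 is infinite, but its terms vanish because `w 0 = f 0 = 0`.
    rcases eq_or_ne n 0 with rfl | hn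
    · have h4 : ∀ b : (fun kd : ℕ × ℕ => kd.1 * kd.2) ⁻¹' {0}, w b.1.1 * f b.1.2 = 0 := by
        rintro ⟨⟨k, d⟩, hkd⟩
        rcases Nat.mul_eq_zero.1 (show k * d = 0 from hkd) with rfl | rfl
        · simp [hw0]
        · simp [hf0]
      rw [tsum_congr h4, tsum_zero]
      simp [dirichletConv]
    · rw [show (fun kd : ℕ × ℕ => kd.1 * kd.2) ⁻¹' {n} = n.divisorsAntidiagonal by ext; simp [hn],
        Finset.tsum_subtype' n.divisorsAntidiagonal fun p => w p.1 * f p.2, dirichletConv]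
  simp_rw [h2] at h1
  rw [expSeries, h1.tsum_eq, hS.tsum_prod]
  refine tsum_congr fun k => ?_
  rw [expSeries, ← tsum_mul_left]
  refine tsum_congr fun d => ?_
  push_cast
  rw [mul_assoc, mul_assoc, mul_left_comm (d : ℝ)]

/-- `x ^ p * ∑ f n e^{-n x}` is bounded for `x > 0` and tends to `l` as `x` tends to `0`. -/
def HasAbelLimit (f : ℕ → ℝ) (p : ℕ) (l : ℝ) : Prop :=
  (∃ C, ∀ x, 0 < x → |x ^ p * expSeries f x| ≤ C) ∧
    Tendsto (fun x => x ^ p * expSeries f x) (𝓝[>] 0) (𝓝 l)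

/-- Grouping by the first factor k gives the terms w k / k^r times the normalized series of f at k
x. Dominated convergence applies as x → 0; since k x is then not small for large k, the bound in
`HasAbelLimit` is needed on all of (0, ∞). -/
theorem HasAbelLimit.dirichletConv {w f : ℕ → ℝ} {p q r : ℕ} {l : ℝ} (h : HasAbelLimit f r l)
    (hw : ∀ k, |w k| ≤ (k : ℝ) ^ p) (hf : ∀ d, |f d| ≤ (d : ℝ) ^ q) (hw0 : w 0 = 0) (hf0 : f 0 = 0)
    (hsum : Summable fun k : ℕ => |w k / (k : ℝ) ^ r|) :
    HasAbelLimit (dirichletConv w f) r ((∑' k : ℕ, w k / (k : ℝ) ^ r) * l) := by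
  obtain ⟨⟨C, hC⟩, hlim⟩ := h
  have hid : ∀ x, 0 < x → x ^ r * expSeries (NWPath.dirichletConv w f) x =
      ∑' k : ℕ, w k / (k : ℝ) ^ r * ((k * x) ^ r * expSeries f (k * x)) := by
    intro x hx
    rw [expSeries_dirichletConv hw hf hw0 hf0 hx, ← tsum_mul_left]
    refine tsum_congr fun k => ?_
    rcases Nat.eq_zero_or_pos k with rfl | hk
    · simp [hw0]
    · have : (k : ℝ) ≠ 0 := by exact_mod_cast hk.ne'
      rw [mul_pow]
      field_simp
  have hbound : ∀ x, 0 < x → ∀ k : ℕ,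
      ‖w k / (k : ℝ) ^ r * ((k * x) ^ r * expSeries f (k * x))‖ ≤ |w k / (k : ℝ) ^ r| * C := by
    intro x hx k
    rw [norm_mul, Real.norm_eq_abs, Real.norm_eq_abs]
    rcases Nat.eq_zero_or_pos k with rfl | hk
    · simp [hw0]
    · exact mul_le_mul_of_nonneg_left (hC _ (mul_pos (by exact_mod_cast hk) hx)) (abs_nonneg _)
  constructor
  · refine ⟨∑' k : ℕ, |w k / (k : ℝ) ^ r| * C, fun x hx => ?_⟩
    rw [hid x hx, ← Real.norm_eq_abs]
    exact tsum_of_norm_bounded (hsum.mul_right C).hasSum (hbound x hx)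
  · rw [← tsum_mul_right]
    refine (tendsto_tsum_of_dominated_convergence (hsum.mul_right C) (fun k => ?_)
      (f := fun x k => w k / (k : ℝ) ^ r * ((k * x) ^ r * expSeries f (k * x)))
      (g := fun k => w k / (k : ℝ) ^ r * l) ?_).congr' ?_
    · rcases Nat.eq_zero_or_pos k with rfl | hk
      · simp [hw0]
      · refine Tendsto.const_mul _ (hlim.comp ?_)
        have hk' : (0 : ℝ) < k := by exact_mod_cast hk
        refine tendsto_nhdsWithin_iff.2 ⟨?_, ?_⟩
        · have : Tendsto (fun x : ℝ => (k : ℝ) * x) (𝓝 0) (𝓝 (k * 0)) :=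
            (continuous_const.mul continuous_id).tendsto 0
          rw [mul_zero] at this
          exact this.mono_left nhdsWithin_le_nhds
        · filter_upwards [self_mem_nhdsWithin] with x hx
          exact mul_pos hk' hx
    · filter_upwards [self_mem_nhdsWithin] with x hx
      exact hbound x hx
    · filter_upwards [self_mem_nhdsWithin] with x hx
      exact (hid x hx).symm

/-! ### Abel limits of the powers of n. -/

theorem one_sub_exp_neg_pos {x : ℝ} (hx : 0 < x) : 0 < 1 - Real.exp (-x) := by
  rw [sub_pos, Real.exp_lt_one_iff]
  linarith

theorem one_le_div_one_sub_exp_neg {x : ℝ} (hx : 0 < x) : 1 ≤ x / (1 - Real.exp (-x)) := by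
  rw [one_le_div (one_sub_exp_neg_pos hx)]
  linarith [Real.add_one_le_exp (-x)]

theorem div_one_sub_exp_neg_le {x : ℝ} (hx : 0 < x) : x / (1 - Real.exp (-x)) ≤ 1 + x := by
  rw [div_le_iff₀ (one_sub_exp_neg_pos hx)]
  have h1 := Real.add_one_le_exp x
  have h2 : Real.exp (-x) * Real.exp x = 1 := by rw [← Real.exp_add]; simp
  nlinarith [Real.exp_pos (-x)]

theorem tendsto_div_one_sub_exp_neg :
    Tendsto (fun x : ℝ => x / (1 - Real.exp (-x))) (𝓝[>] 0) (𝓝 1) := by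
  refine tendsto_of_tendsto_of_tendsto_of_le_of_le' tendsto_const_nhds
    (h := fun x : ℝ => 1 + x) ?_ ?_ ?_
  · have : Tendsto (fun x : ℝ => 1 + x) (𝓝 0) (𝓝 (1 + 0)) :=
      (continuous_const.add continuous_id).tendsto 0
    rw [add_zero] at this
    exact this.mono_left nhdsWithin_le_nhds
  · filter_upwards [self_mem_nhdsWithin] with x hx using one_le_div_one_sub_exp_neg hx
  · filter_upwards [self_mem_nhdsWithin] with x hx using div_one_sub_exp_neg_le hx

theorem one_add_pow_mul_exp_neg_le {p : ℕ} (hp : 0 < p) {x : ℝ} (hx : 0 < x) :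
    (1 + x) ^ p * Real.exp (-x) ≤ (p : ℝ) ^ p := by
  have hp' : (1 : ℝ) ≤ p := by exact_mod_cast hp
  have h1 : Real.exp x = Real.exp (x / p) ^ p := by
    rw [← Real.exp_nat_mul]
    congr 1
    field_simp
  rw [Real.exp_neg, ← div_eq_mul_inv, div_le_iff₀ (Real.exp_pos x), h1, ← mul_pow]
  refine pow_le_pow_left₀ (by linarith) ?_ p
  have h2 := Real.add_one_le_exp (x / p)
  have h3 : (p : ℝ) * (x / p + 1) = x + p := by field_simp
  nlinarith

/-- At y = e^{-x} the powers of x / (1 - e^{-x}) tend to 1 as x → 0. For large x they grow like x^p,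
which the spare factor y absorbs. -/
theorem hasAbelLimit_of_hasSum {f : ℕ → ℝ} {p : ℕ} (hp : 0 < p) {Q : ℝ → ℝ} {K : ℝ}
    (hQ : Continuous Q) (hK : ∀ y, 0 ≤ y → y ≤ 1 → |Q y| ≤ K)
    (h : ∀ y : ℝ, 0 ≤ y → y < 1 → HasSum (fun n => f n * y ^ n) (y * Q y / (1 - y) ^ p)) :
    HasAbelLimit f p (Q 1) := by
  have hid : ∀ x, 0 < x → x ^ p * expSeries f x =
      (x / (1 - Real.exp (-x))) ^ p * (Real.exp (-x) * Q (Real.exp (-x))) := by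
    intro x hx
    have h1 := h (Real.exp (-x)) (Real.exp_nonneg _) (Real.exp_lt_one_iff.2 (by linarith))
    rw [expSeries]
    simp_rw [exp_neg_nat_mul]
    rw [h1.tsum_eq, div_pow]
    ring
  constructor
  · refine ⟨(p : ℝ) ^ p * K, fun x hx => ?_⟩
    have h0 := one_sub_exp_neg_pos hx
    have hK' := hK (Real.exp (-x)) (Real.exp_nonneg _) (Real.exp_le_one_iff.2 (by linarith))
    rw [hid x hx, abs_mul, abs_mul, abs_of_nonneg (by positivity), abs_of_nonneg (Real.exp_nonneg _),
      ← mul_assoc]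
    refine mul_le_mul ?_ hK' (abs_nonneg _) (by positivity)
    refine le_trans ?_ (one_add_pow_mul_exp_neg_le hp hx)
    gcongr
    exact div_one_sub_exp_neg_le hx
  · have h1 : Tendsto (fun x : ℝ => Real.exp (-x)) (𝓝[>] 0) (𝓝 1) := by
      have : Tendsto (fun x : ℝ => Real.exp (-x)) (𝓝 0) (𝓝 (Real.exp (-0))) :=
        (Real.continuous_exp.comp continuous_neg).tendsto 0
      rw [neg_zero, Real.exp_zero] at this
      exact this.mono_left nhdsWithin_le_nhds
    have h2 := (tendsto_div_one_sub_exp_neg.pow p).mul (h1.mul ((hQ.tendsto 1).comp h1))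
    rw [one_pow, one_mul, one_mul] at h2
    refine h2.congr' ?_
    filter_upwards [self_mem_nhdsWithin] with x hx
    exact (hid x hx).symm

theorem hasSum_choose_mul_pow (k : ℕ) {y : ℝ} (hy : 0 ≤ y) (hy1 : y < 1) :
    HasSum (fun n : ℕ => ((n + k).choose k : ℝ) * y ^ n) (1 / (1 - y) ^ (k + 1)) :=
  hasSum_choose_mul_geometric_of_norm_lt_one k (by rwa [Real.norm_of_nonneg hy])

theorem hasSum_value_eq {f : ℕ → ℝ} {a b : ℝ} (h : HasSum f a) (hab : a = b) : HasSum f b := hab ▸ h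

theorem cast_choose_two (n : ℕ) : ((n + 2).choose 2 : ℝ) = (n + 1) * (n + 2) / 2 := by
  rw [Nat.cast_choose_two]
  push_cast
  ring

theorem cast_choose_three (n : ℕ) : ((n + 3).choose 3 : ℝ) = (n + 1) * (n + 2) * (n + 3) / 6 := by
  have h := Nat.add_one_mul_choose_eq (n + 2) 2
  have h' : ((n + 2 : ℕ) + 1 : ℝ) * ((n + 2).choose 2 : ℝ) = ((n + 3).choose 3 : ℝ) * (2 + 1) := by
    exact_mod_cast h
  rw [cast_choose_two] at h'
  push_cast at h'
  linarith

theorem cast_choose_four (n : ℕ) :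
    ((n + 4).choose 4 : ℝ) = (n + 1) * (n + 2) * (n + 3) * (n + 4) / 24 := by
  have h := Nat.add_one_mul_choose_eq (n + 3) 3
  have h' : ((n + 3 : ℕ) + 1 : ℝ) * ((n + 3).choose 3 : ℝ) = ((n + 4).choose 4 : ℝ) * (3 + 1) := by
    exact_mod_cast h
  rw [cast_choose_three] at h'
  push_cast at h'
  linarith

/-- Here and in the next two results `Q` is the Eulerian polynomial in Σ n^m y^n = y Q(y) / (1 -
y)^(m+1), so Q(1) = m!. The series comes from expanding n^m in the binomials C(n + k, k). -/
theorem hasAbelLimit_sq : HasAbelLimit (fun n => (n : ℝ) ^ 2) 3 2 := by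
  have h := hasAbelLimit_of_hasSum (f := fun n => (n : ℝ) ^ 2) (p := 3) (Q := fun y => 1 + y)
    (K := 2) (by norm_num) (by fun_prop) (fun y h0 h1 => by rw [abs_le]; constructor <;> linarith) ?_
  · norm_num at h
    exact h
  · intro y hy hy1
    have h1 := ((hasSum_choose_mul_pow 2 hy hy1).mul_left 2).sub
      ((hasSum_choose_mul_pow 1 hy hy1).mul_left 3) |>.add (hasSum_choose_mul_pow 0 hy hy1)
    have hy' : 1 - y ≠ 0 := by linarith
    refine ((hasSum_value_eq h1 ?_).congr_fun fun n => ?_)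
    · field_simp
      ring
    rw [cast_choose_two]
    simp
    ring

theorem hasAbelLimit_cube : HasAbelLimit (fun n => (n : ℝ) ^ 3) 4 6 := by
  have h := hasAbelLimit_of_hasSum (f := fun n => (n : ℝ) ^ 3) (p := 4)
    (Q := fun y => 1 + 4 * y + y ^ 2)
    (K := 6) (by norm_num) (by fun_prop)
    (fun y h0 h1 => by rw [abs_le]; constructor <;> nlinarith) ?_
  · norm_num at h
    exact h
  · intro y hy hy1
    have h1 := (((hasSum_choose_mul_pow 3 hy hy1).mul_left 6).sub
      ((hasSum_choose_mul_pow 2 hy hy1).mul_left 12) |>.add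
      ((hasSum_choose_mul_pow 1 hy hy1).mul_left 7)).sub (hasSum_choose_mul_pow 0 hy hy1)
    have hy' : 1 - y ≠ 0 := by linarith
    refine ((hasSum_value_eq h1 ?_).congr_fun fun n => ?_)
    · field_simp
      ring
    rw [cast_choose_two, cast_choose_three]
    simp
    ring

theorem hasAbelLimit_fourth : HasAbelLimit (fun n => (n : ℝ) ^ 4) 5 24 := by
  have h := hasAbelLimit_of_hasSum (f := fun n => (n : ℝ) ^ 4) (p := 5)
    (Q := fun y => 1 + 11 * y + 11 * y ^ 2 + y ^ 3)
    (K := 24) (by norm_num) (by fun_prop)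
    (fun y h0 h1 => by
      have h2 : y ^ 2 ≤ 1 := by nlinarith
      have h3 : y ^ 3 ≤ 1 := pow_le_one₀ h0 h1
      rw [abs_of_nonneg (by positivity)]
      linarith) ?_
  · norm_num at h
    exact h
  · intro y hy hy1
    have h1 := ((((hasSum_choose_mul_pow 4 hy hy1).mul_left 24).sub
      ((hasSum_choose_mul_pow 3 hy hy1).mul_left 60) |>.add
      ((hasSum_choose_mul_pow 2 hy hy1).mul_left 50)).sub
      ((hasSum_choose_mul_pow 1 hy hy1).mul_left 15)).add (hasSum_choose_mul_pow 0 hy hy1)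
    have hy' : 1 - y ≠ 0 := by linarith
    refine ((hasSum_value_eq h1 ?_).congr_fun fun n => ?_)
    · field_simp
      ring
    rw [cast_choose_two, cast_choose_three, cast_choose_four]
    simp
    ring

/-! ### Abel limits of the totient sums. -/

theorem sum_moebius_mul (d : ℕ) :
    ∑ p ∈ d.divisorsAntidiagonal, (μ p.1 : ℝ) * p.2 = d.totient := by
  rcases Nat.eq_zero_or_pos d with rfl | hd
  · simp
  · refine (ArithmeticFunction.sum_eq_iff_sum_mul_moebius_eq (R := ℝ) (f := fun n => (n.totient : ℝ))
      (g := fun n => (n : ℝ))).1 (fun n _ => ?_) d hd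
    exact_mod_cast Nat.sum_totient n

theorem dirichletConv_moebius (i : ℕ) :
    dirichletConv (fun l => (μ l : ℝ) * (l : ℝ) ^ (i + 1)) (fun e => (e : ℝ) ^ (i + 2)) =
      fun d : ℕ => (d : ℝ) ^ (i + 1) * d.totient := by
  ext d
  rw [dirichletConv, ← sum_moebius_mul, Finset.mul_sum]
  refine Finset.sum_congr rfl fun p hp => ?_
  rw [← (Nat.mem_divisorsAntidiagonal.1 hp).1]
  push_cast
  ring

theorem dirichletConv_totient (i : ℕ) :
    -- The case distinction makes the weight vanish at 0 also for `i = 0`, where `0 ^ 0 = 1`.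
    dirichletConv (fun k => if k = 0 then 0 else (k : ℝ) ^ i)
      (fun d : ℕ => (d : ℝ) ^ (i + 1) * d.totient) =
      fun n : ℕ => (n : ℝ) ^ i * totientSum n := by
  ext n
  have h := Nat.sum_divisorsAntidiagonal' (fun _ d => d * d.totient) (n := n)
  rw [dirichletConv, totientSum, ← h]
  push_cast
  rw [Finset.mul_sum]
  refine Finset.sum_congr rfl fun p hp => ?_
  rw [← (Nat.mem_divisorsAntidiagonal.1 hp).1]
  rw [if_neg (Nat.ne_zero_of_mem_divisorsAntidiagonal hp).1]
  push_cast
  ring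

theorem abs_moebius_le (l : ℕ) : |(μ l : ℝ)| ≤ 1 := by
  exact_mod_cast ArithmeticFunction.abs_moebius_le_one (n := l)

/-- The sequence is the convolution of k^i, μ(l) l^(i+1) and e^(i+2). Dividing the two weights by
the power i + 3 leaves 1 / k³ and μ(l) / l², independently of i, so the limit is multiplied by ζ(3)
/ ζ(2). -/
theorem hasAbelLimit_totientSum {i : ℕ} {l : ℝ}
    (h : HasAbelLimit (fun n => (n : ℝ) ^ (i + 2)) (i + 3) l) :
    HasAbelLimit (fun n => (n : ℝ) ^ i * totientSum n) (i + 3)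
      ((∑' k : ℕ, 1 / (k : ℝ) ^ 3) * ((∑' k : ℕ, (μ k : ℝ) / (k : ℝ) ^ 2) * l)) := by
  have e1 : ∀ k : ℕ, (μ k : ℝ) * (k : ℝ) ^ (i + 1) / (k : ℝ) ^ (i + 3) = μ k / (k : ℝ) ^ 2 := by
    intro k
    rcases Nat.eq_zero_or_pos k with rfl | hk
    · simp
    · have : (k : ℝ) ≠ 0 := by exact_mod_cast hk.ne'
      field_simp
      ring
  have e2 : ∀ k : ℕ, (if k = 0 then 0 else (k : ℝ) ^ i) / (k : ℝ) ^ (i + 3) = 1 / (k : ℝ) ^ 3 := by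
    intro k
    rcases Nat.eq_zero_or_pos k with rfl | hk
    · simp
    · have : (k : ℝ) ≠ 0 := by exact_mod_cast hk.ne'
      rw [if_neg hk.ne']
      field_simp
      ring
  have h1 := h.dirichletConv (w := fun l => (μ l : ℝ) * (l : ℝ) ^ (i + 1)) (p := i + 1) (q := i + 2)
    (fun k => by
      rw [abs_mul, abs_of_nonneg (by positivity : (0 : ℝ) ≤ (k : ℝ) ^ (i + 1))]
      exact mul_le_of_le_one_left (by positivity) (abs_moebius_le k))
    (fun d => by rw [abs_of_nonneg (by positivity)]) (by simp) (by simp)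
    (by
      simp_rw [e1]
      refine Summable.of_nonneg_of_le (fun _ => abs_nonneg _) (fun k => ?_)
        (Real.summable_one_div_nat_pow.2 (by norm_num : 1 < 2))
      rw [abs_div, abs_of_nonneg (by positivity : (0 : ℝ) ≤ (k : ℝ) ^ 2)]
      gcongr
      exact abs_moebius_le k)
  simp_rw [e1] at h1
  rw [dirichletConv_moebius] at h1
  have h2 := h1.dirichletConv (w := fun k => if k = 0 then 0 else (k : ℝ) ^ i) (p := i) (q := i + 2)
    (fun k => by
      split_ifs
      · simp
      · rw [abs_of_nonneg (by positivity)])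
    (fun d => by
      rw [abs_of_nonneg (by positivity), pow_succ (d : ℝ) (i + 1)]
      gcongr
      exact Nat.totient_le d) (by simp) (by simp)
    (by
      simp_rw [e2]
      refine (Real.summable_one_div_nat_pow.2 (by norm_num : 1 < 3)).congr fun k => ?_
      rw [abs_of_nonneg (by positivity)])
  simp_rw [e2] at h2
  rwa [dirichletConv_totient] at h2

theorem tsum_one_div_cube : ∑' k : ℕ, 1 / (k : ℝ) ^ 3 = (riemannZeta 3).re := by
  have h := zeta_nat_eq_tsum_of_gt_one (k := 3) (by norm_num)
  have h' : riemannZeta 3 = ((∑' k : ℕ, 1 / (k : ℝ) ^ 3 : ℝ) : ℂ) := by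
    push_cast at h ⊢
    exact h
  rw [h', Complex.ofReal_re]

theorem zeta_three_pos : 0 < (riemannZeta 3).re := by
  rw [← tsum_one_div_cube]
  exact (Real.summable_one_div_nat_pow.2 (by norm_num : 1 < 3)).tsum_pos (fun k => by positivity) 1
    (by norm_num)

theorem tsum_moebius_div_sq : ∑' k : ℕ, (μ k : ℝ) / (k : ℝ) ^ 2 = 6 / Real.pi ^ 2 := by
  have h := ArithmeticFunction.LSeries_zeta_mul_Lseries_moebius (s := 2) (by norm_num)
  rw [ArithmeticFunction.LSeries_zeta_eq_riemannZeta (by norm_num), riemannZeta_two] at h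
  have h2 : LSeries (fun n => ((μ n : ℤ) : ℂ)) 2 =
      ((∑' k : ℕ, (μ k : ℝ) / (k : ℝ) ^ 2 : ℝ) : ℂ) := by
    rw [LSeries]
    push_cast
    refine tsum_congr fun k => ?_
    rcases Nat.eq_zero_or_pos k with rfl | hk
    · simp
    · rw [LSeries.term_of_ne_zero hk.ne']
      norm_num
  rw [h2] at h
  have h3 : Real.pi ^ 2 / 6 * ∑' k : ℕ, (μ k : ℝ) / (k : ℝ) ^ 2 = 1 := by exact_mod_cast h
  have := Real.pi_pos
  field_simp at h3 ⊢
  linarith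

/-- The constant `ζ(3) / ζ(2)`. -/
noncomputable def saddleConst : ℝ := (riemannZeta 3).re * (6 / Real.pi ^ 2)

theorem saddleConst_pos : 0 < saddleConst :=
  mul_pos zeta_three_pos (by positivity)

/-- The derivatives of the logarithm of the generating function at `e^{-t}`, up to sign. -/
noncomputable def moment (i : ℕ) (t : ℝ) : ℝ := expSeries (fun n => (n : ℝ) ^ i * totientSum n) t

theorem tendsto_moment_zero :
    Tendsto (fun t => t ^ 3 * moment 0 t) (𝓝[>] 0) (𝓝 (2 * saddleConst)) := by
  have h := (hasAbelLimit_totientSum (i := 0) hasAbelLimit_sq).2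
  have e : (riemannZeta 3).re * (6 / Real.pi ^ 2 * 2) = 2 * saddleConst := by
    unfold saddleConst
    ring
  rw [tsum_one_div_cube, tsum_moebius_div_sq, e] at h
  exact h

theorem tendsto_moment_one :
    Tendsto (fun t => t ^ 4 * moment 1 t) (𝓝[>] 0) (𝓝 (6 * saddleConst)) := by
  have h := (hasAbelLimit_totientSum (i := 1) hasAbelLimit_cube).2
  have e : (riemannZeta 3).re * (6 / Real.pi ^ 2 * 6) = 6 * saddleConst := by
    unfold saddleConst
    ring
  rw [tsum_one_div_cube, tsum_moebius_div_sq, e] at h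
  exact h

theorem moment_two_le : ∃ C, 0 < C ∧ ∀ t, 0 < t → t ^ 5 * moment 2 t ≤ C := by
  obtain ⟨C, hC⟩ := (hasAbelLimit_totientSum (i := 2) hasAbelLimit_fourth).1
  exact ⟨max C 1, by positivity, fun t ht =>
    (le_abs_self _).trans ((hC t ht).trans (le_max_left _ _))⟩

end NWPath

namespace NWPath

open scoped Topology

/-! ### Estimates for the generating function near and away from the saddle point -/

/-- The logarithm of the generating function on the circle of radius `e^{-t}`, normalized to
vanish to the first order at `θ = 0`. -/
noncomputable def saddleLog (t θ : ℝ) : ℂ :=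
  logGenFun (Complex.exp (-t + θ * Complex.I)) - logGenFun (Complex.exp (-t)) -
    θ * Complex.I * moment 0 t

/-- The Taylor remainder of the exponential on the imaginary axis. -/
noncomputable def expRem (x : ℝ) : ℂ := Complex.exp (x * Complex.I) - 1 - x * Complex.I

/-- Taylor's bound for |x| ≤ 1; beyond, each term is separately at most a multiple of |x|³. A bound
for all x is needed since it is applied at n θ for every n. -/
theorem norm_expRem_add_le (x : ℝ) : ‖expRem x + x ^ 2 / 2‖ ≤ 4 * |x| ^ 3 := by
  have hx0 : 0 ≤ |x| := abs_nonneg x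
  have hI : ‖(x * Complex.I : ℂ)‖ = |x| := by simp
  rcases le_total |x| 1 with hx | hx
  · have h := Complex.exp_bound (x := x * Complex.I) (by rwa [hI]) (n := 3) (by norm_num)
    rw [hI] at h
    have e : Complex.exp (x * Complex.I) - ∑ m ∈ Finset.range 3, (x * Complex.I : ℂ) ^ m /
        (m.factorial : ℂ) = expRem x + x ^ 2 / 2 := by
      simp only [Finset.sum_range_succ, Finset.sum_range_zero, expRem, mul_pow, Complex.I_sq,
        Nat.factorial]
      push_cast
      ring
    rw [e] at h
    refine h.trans ?_
    norm_num [Nat.factorial]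
    nlinarith [pow_nonneg hx0 3]
  · have h1 : ‖Complex.exp (x * Complex.I)‖ = 1 := Complex.norm_exp_ofReal_mul_I x
    have h2 : ‖((x : ℂ) ^ 2 / 2)‖ = |x| ^ 2 / 2 := by simp
    calc ‖expRem x + x ^ 2 / 2‖ ≤ ‖expRem x‖ + ‖((x : ℂ) ^ 2 / 2)‖ := norm_add_le _ _
      _ ≤ (‖Complex.exp (x * Complex.I)‖ + ‖(1 : ℂ)‖ + ‖(x * Complex.I : ℂ)‖) + |x| ^ 2 / 2 := by
          rw [h2, expRem]
          gcongr
          exact (norm_sub_le _ _).trans (add_le_add_left (norm_sub_le _ _) _)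
      _ = 2 + |x| + |x| ^ 2 / 2 := by
          rw [h1, hI, norm_one]
          ring
      _ ≤ 4 * |x| ^ 3 := by
          have h3 : |x| ≤ |x| ^ 2 := by nlinarith
          have h4 : |x| ^ 2 ≤ |x| ^ 3 := by nlinarith
          linarith

theorem expRem_re (x : ℝ) : (expRem x).re = -(1 - Real.cos x) := by
  rw [expRem, Complex.sub_re, Complex.sub_re, Complex.exp_ofReal_mul_I_re]
  simp

/-- The coefficients of the logarithm of the generating function at `e^{-t}`. -/
noncomputable def logCoeff (t : ℝ) (n : ℕ) : ℝ := totientSum n / n * Real.exp (-(n * t))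

theorem logCoeff_nonneg (t : ℝ) (n : ℕ) : 0 ≤ logCoeff t n := by
  unfold logCoeff
  positivity

theorem logCoeff_mul (t : ℝ) (n i : ℕ) :
    logCoeff t n * (n : ℝ) ^ (i + 1) = (n : ℝ) ^ i * totientSum n * Real.exp (-(n * t)) := by
  rcases Nat.eq_zero_or_pos n with rfl | hn
  · simp [logCoeff, totientSum]
  · have : (n : ℝ) ≠ 0 := by exact_mod_cast hn.ne'
    rw [logCoeff]
    field_simp
    ring

theorem hasSum_moment (i : ℕ) {t : ℝ} (ht : 0 < t) :
    HasSum (fun n : ℕ => logCoeff t n * (n : ℝ) ^ (i + 1)) (moment i t) := by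
  simp_rw [logCoeff_mul, exp_neg_nat_mul]
  have h := (summable_totientSum_mul_pow (Real.exp_nonneg (-t))
    (Real.exp_lt_one_iff.2 (by linarith)) i).hasSum
  rw [moment, expSeries]
  simp_rw [exp_neg_nat_mul]
  exact h

theorem summable_logCoeff {t : ℝ} (ht : 0 < t) : Summable (logCoeff t) := by
  refine Summable.of_nonneg_of_le (logCoeff_nonneg t) (fun n => ?_) (hasSum_moment 0 ht).summable
  rcases Nat.eq_zero_or_pos n with rfl | hn
  · simp [logCoeff]
  · have : (1 : ℝ) ≤ n := by exact_mod_cast hn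
    rw [zero_add, pow_one]
    exact le_mul_of_one_le_right (logCoeff_nonneg t n) this

theorem logGenFun_cexp (t θ : ℝ) : logGenFun (Complex.exp (-t + θ * Complex.I)) =
    ∑' n : ℕ, (logCoeff t n : ℂ) * Complex.exp ((n * θ : ℝ) * Complex.I) := by
  refine tsum_congr fun n => ?_
  rw [← Complex.exp_nat_mul, logCoeff, Complex.ofReal_mul, mul_assoc, Complex.ofReal_exp,
    ← Complex.exp_add]
  congr 2
  push_cast
  ring

theorem hasSum_logGenFun_cexp {t : ℝ} (ht : 0 < t) (θ : ℝ) :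
    HasSum (fun n : ℕ => (logCoeff t n : ℂ) * Complex.exp ((n * θ : ℝ) * Complex.I))
      (logGenFun (Complex.exp (-t + θ * Complex.I))) := by
  rw [logGenFun_cexp]
  refine Summable.hasSum (Summable.of_norm ?_)
  refine (summable_logCoeff ht).congr fun n => ?_
  rw [norm_mul, Complex.norm_exp_ofReal_mul_I, mul_one, Complex.norm_real,
    Real.norm_of_nonneg (logCoeff_nonneg t n)]

theorem hasSum_saddleLog {t : ℝ} (ht : 0 < t) (θ : ℝ) :
    HasSum (fun n : ℕ => (logCoeff t n : ℂ) * expRem (n * θ)) (saddleLog t θ) := by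
  have h0 := hasSum_logGenFun_cexp ht 0
  simp only [mul_zero, Complex.ofReal_zero, zero_mul, Complex.exp_zero, mul_one, add_zero] at h0
  have h1 := (Complex.hasSum_ofReal.2 (hasSum_moment 0 ht)).mul_left (θ * Complex.I)
  refine (((hasSum_logGenFun_cexp ht θ).sub h0).sub h1).congr_fun fun n => ?_
  rw [expRem]
  push_cast
  ring

theorem norm_saddleLog_add_le {t : ℝ} (ht : 0 < t) (θ : ℝ) :
    ‖saddleLog t θ + θ ^ 2 / 2 * moment 1 t‖ ≤ 4 * |θ| ^ 3 * moment 2 t := by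
  have h1 := (Complex.hasSum_ofReal.2 (hasSum_moment 1 ht)).mul_left ((θ : ℂ) ^ 2 / 2)
  have h2 := (hasSum_saddleLog ht θ).add h1
  rw [← h2.tsum_eq]
  refine tsum_of_norm_bounded ((hasSum_moment 2 ht).mul_left (4 * |θ| ^ 3)) fun n => ?_
  have e : (logCoeff t n : ℂ) * expRem (n * θ) +
      (θ : ℂ) ^ 2 / 2 * ((logCoeff t n * (n : ℝ) ^ (1 + 1) : ℝ) : ℂ) =
      logCoeff t n * (expRem (n * θ) + ((n * θ : ℝ) : ℂ) ^ 2 / 2) := by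
    push_cast
    ring
  rw [e, norm_mul, Complex.norm_real, Real.norm_of_nonneg (logCoeff_nonneg t n)]
  calc logCoeff t n * ‖expRem (n * θ) + ((n * θ : ℝ) : ℂ) ^ 2 / 2‖
      ≤ logCoeff t n * (4 * |n * θ| ^ 3) :=
        mul_le_mul_of_nonneg_left (norm_expRem_add_le _) (logCoeff_nonneg t n)
    _ = 4 * |θ| ^ 3 * (logCoeff t n * (n : ℝ) ^ (2 + 1)) := by
        rw [abs_mul, Nat.abs_cast, mul_pow]
        ring

theorem saddleLog_re_le {t : ℝ} (ht : 0 < t) (θ : ℝ) :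
    (saddleLog t θ).re ≤ -(θ ^ 2 / 2 * moment 1 t) + 4 * |θ| ^ 3 * moment 2 t := by
  have h := (Complex.abs_re_le_norm _).trans (norm_saddleLog_add_le ht θ)
  have e : (saddleLog t θ + θ ^ 2 / 2 * moment 1 t : ℂ).re =
      (saddleLog t θ).re + θ ^ 2 / 2 * moment 1 t := by
    rw [Complex.add_re]
    norm_cast
  rw [e] at h
  linarith [le_abs_self ((saddleLog t θ).re + θ ^ 2 / 2 * moment 1 t)]

theorem le_totientSum (n : ℕ) : n ≤ totientSum n := by
  rcases Nat.eq_zero_or_pos n with rfl | hn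
  · exact Nat.zero_le _
  · calc n ≤ n * n.totient := Nat.le_mul_of_pos_right n (Nat.totient_pos.2 hn)
      _ ≤ totientSum n := Finset.single_le_sum (f := fun d => d * d.totient) (fun _ _ => Nat.zero_le _)
          (Nat.mem_divisors_self n hn.ne')

theorem exp_le_logCoeff (t : ℝ) {n : ℕ} (hn : 0 < n) : Real.exp (-(n * t)) ≤ logCoeff t n := by
  have hn' : (0 : ℝ) < n := by exact_mod_cast hn
  refine le_mul_of_one_le_left (Real.exp_nonneg _) ?_
  rw [one_le_div hn']
  exact_mod_cast le_totientSum n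

/-- The real part is minus the sum of `logCoeff t n` (1 - cos nθ). For n ≥ 1 these coefficients are
at least e^{-nt}, so a geometric series gives an explicit upper bound. -/
theorem saddleLog_re_le_geometric {t : ℝ} (ht : 0 < t) (θ : ℝ) :
    (saddleLog t θ).re ≤
      ‖(1 - Complex.exp (-t + θ * Complex.I))⁻¹‖ - (1 - Real.exp (-t))⁻¹ := by
  have h1 := Complex.hasSum_re (hasSum_saddleLog ht θ)
  have h2 := Complex.hasSum_re (hasSum_geometric_of_norm_lt_one (norm_cexp_lt_one ht θ))
  have h3 := hasSum_geometric_of_lt_one (Real.exp_nonneg (-t))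
    (Real.exp_lt_one_iff.2 (by linarith))
  refine le_trans (hasSum_le (fun n => ?_) h1 (h2.sub h3))
    (sub_le_sub_right (Complex.re_le_norm _) _)
  have e : (Complex.exp (-t + θ * Complex.I) ^ n).re = Real.exp (-(n * t)) * Real.cos (n * θ) := by
    have : Complex.exp (-t + θ * Complex.I) ^ n =
        ((Real.exp (-(n * t)) : ℝ) : ℂ) * Complex.exp ((n * θ : ℝ) * Complex.I) := by
      rw [← Complex.exp_nat_mul, Complex.ofReal_exp, ← Complex.exp_add]
      congr 1
      push_cast
      ring
    rw [this, Complex.re_ofReal_mul, Complex.exp_ofReal_mul_I_re]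
  rw [e, Complex.re_ofReal_mul, expRem_re, ← exp_neg_nat_mul]
  rcases Nat.eq_zero_or_pos n with rfl | hn
  · simp
  · nlinarith [exp_le_logCoeff t hn, Real.cos_le_one (n * θ)]

theorem norm_one_sub_cexp_sq (t θ : ℝ) :
    ‖1 - Complex.exp (-t + θ * Complex.I)‖ ^ 2 =
      (1 - Real.exp (-t)) ^ 2 + 2 * Real.exp (-t) * (1 - Real.cos θ) := by
  have e : Complex.exp (-t + θ * Complex.I) =
      ((Real.exp (-t) : ℝ) : ℂ) * Complex.exp (θ * Complex.I) := by
    rw [Complex.ofReal_exp, ← Complex.exp_add]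
    push_cast
    rfl
  rw [← Complex.normSq_eq_norm_sq, Complex.normSq_apply, e, Complex.sub_re, Complex.sub_im,
    Complex.re_ofReal_mul, Complex.im_ofReal_mul, Complex.exp_ofReal_mul_I_re,
    Complex.exp_ofReal_mul_I_im, Complex.one_re, Complex.one_im]
  linear_combination Real.exp (-t) ^ 2 * Real.sin_sq_add_cos_sq θ

theorem one_sub_exp_neg_le_norm (t θ : ℝ) :
    1 - Real.exp (-t) ≤ ‖1 - Complex.exp (-t + θ * Complex.I)‖ := by
  refine le_of_sq_le_sq ?_ (norm_nonneg _)
  rw [norm_one_sub_cexp_sq]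
  have h1 := Real.cos_le_one θ
  have h2 := Real.exp_nonneg (-t)
  nlinarith [mul_nonneg h2 (sub_nonneg.2 h1)]

theorem saddleLog_re_le_of_le_abs {δ : ℝ} (hδ : 0 < δ) :
    ∃ c, 0 < c ∧ ∀ t θ : ℝ, 0 < t → t ≤ 1 → δ * t ≤ |θ| → |θ| ≤ Real.pi →
      (saddleLog t θ).re ≤ -(c / t) := by
  -- The value comes from 1 - cos θ ≥ 2θ²/π², e^{-t} ≥ 1/3 and 1 - e^{-t} ≤ t: together they give |1
  -- - z|² ≥ (1 + κ)(1 - e^{-t})².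
  set κ := 4 * δ ^ 2 / (3 * Real.pi ^ 2) with hκ
  have hπ := Real.pi_pos
  have hκ0 : 0 < κ := by positivity
  set s := Real.sqrt (1 + κ)
  have hs2 : s ^ 2 = 1 + κ := Real.sq_sqrt (by positivity)
  have hs1 : 1 < s := by
    have : 0 ≤ s := Real.sqrt_nonneg _
    nlinarith
  have hs0 : 0 < s := by linarith
  refine ⟨1 - 1 / s, by rw [sub_pos, div_lt_one hs0]; exact hs1, fun t θ ht ht1 h1 h2 => ?_⟩
  refine (saddleLog_re_le_geometric ht θ).trans ?_
  have hpos := one_sub_exp_neg_pos ht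
  have hle : 1 - Real.exp (-t) ≤ t := by linarith [Real.add_one_le_exp (-t)]
  have hy : 1 / 3 ≤ Real.exp (-t) := by
    have h3 : Real.exp (-1) ≤ Real.exp (-t) := Real.exp_le_exp.2 (by linarith)
    have h4 := Real.exp_one_lt_d9
    have h5 : Real.exp (-1) * Real.exp 1 = 1 := by rw [← Real.exp_add]; simp
    nlinarith [Real.exp_pos (-1)]
  have hcos := Real.cos_le_one_sub_mul_cos_sq h2
  have hθ : δ ^ 2 * t ^ 2 ≤ θ ^ 2 := by
    rw [← sq_abs θ, ← mul_pow]
    exact pow_le_pow_left₀ (by positivity) h1 2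
  have hnorm : s * (1 - Real.exp (-t)) ≤ ‖1 - Complex.exp (-t + θ * Complex.I)‖ := by
    refine le_of_sq_le_sq ?_ (norm_nonneg _)
    rw [norm_one_sub_cexp_sq, mul_pow, hs2]
    have h5 : 2 / Real.pi ^ 2 * (δ ^ 2 * t ^ 2) ≤ 1 - Real.cos θ := by
      have := mul_le_mul_of_nonneg_left hθ (by positivity : 0 ≤ 2 / Real.pi ^ 2)
      linarith
    have h6 : κ * (1 - Real.exp (-t)) ^ 2 ≤ κ * t ^ 2 := by gcongr
    have h7 : κ * t ^ 2 = 2 * (1 / 3) * (2 / Real.pi ^ 2 * (δ ^ 2 * t ^ 2)) := by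
      rw [hκ]
      field_simp
      ring
    have h8 : 2 * (1 / 3) * (2 / Real.pi ^ 2 * (δ ^ 2 * t ^ 2)) ≤
        2 * Real.exp (-t) * (1 - Real.cos θ) := by
      gcongr
    linarith
  rw [norm_inv]
  have h9 : ‖1 - Complex.exp (-t + θ * Complex.I)‖⁻¹ ≤ 1 / s * (1 - Real.exp (-t))⁻¹ := by
    rw [one_div, ← mul_inv]
    exact inv_anti₀ (by positivity) hnorm
  have h10 : t⁻¹ ≤ (1 - Real.exp (-t))⁻¹ := inv_anti₀ hpos hle
  have h11 : 0 < 1 - 1 / s := by rw [sub_pos, div_lt_one hs0]; exact hs1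
  have h12 := mul_le_mul_of_nonneg_left h10 h11.le
  rw [div_eq_mul_inv]
  linarith

end NWPath

namespace NWPath

open scoped Topology
open MeasureTheory

/-! ### The saddle point integral -/

/-- An integrable majorant uniform in t, at the scale θ = t² u on which the quadratic term has order
one. For |θ| ≤ δ t the quadratic term dominates the cubic one and the decay is Gaussian. Elsewhere
e^{-c/t} ≤ 24 (t/c)⁴ beats 1 + u², which is at most (1 + π²) / t⁴. -/
theorem exists_norm_cexp_saddleLog_le : ∃ K t₀, 0 < t₀ ∧ t₀ ≤ 1 ∧ ∀ t u : ℝ, 0 < t → t ≤ t₀ →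
    |t ^ 2 * u| ≤ Real.pi → ‖Complex.exp (saddleLog t (t ^ 2 * u))‖ ≤ K * (1 + u ^ 2)⁻¹ := by
  have hA := saddleConst_pos
  set A := saddleConst
  obtain ⟨C, hC, hM2⟩ := moment_two_le
  -- Chosen so that the cubic error is at most A u², half of the lower bound 2 A u² for the
  -- quadratic term.
  set δ := A / (4 * C) with hδ
  have hδ0 : 0 < δ := by positivity
  obtain ⟨c, hc, hfar⟩ := saddleLog_re_le_of_le_abs hδ0
  have hM1 : ∀ᶠ t in 𝓝[>] (0 : ℝ), 4 * A < t ^ 4 * moment 1 t :=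
    tendsto_moment_one.eventually (lt_mem_nhds (by linarith))
  obtain ⟨t₁, ht₁, hsub⟩ := mem_nhdsGT_iff_exists_Ioc_subset.1 hM1
  have ht₁' : (0 : ℝ) < t₁ := ht₁
  refine ⟨max (1 + 1 / A) (24 / c ^ 4 * (1 + Real.pi ^ 2)), min t₁ 1, lt_min ht₁' one_pos,
    min_le_right _ _, fun t u ht htle hu => ?_⟩
  have ht1 : t ≤ 1 := htle.trans (min_le_right _ _)
  have hM1t : 4 * A < t ^ 4 * moment 1 t := hsub ⟨ht, htle.trans (min_le_left _ _)⟩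
  have hu1 : 0 < 1 + u ^ 2 := by positivity
  rw [Complex.norm_exp, ← div_eq_mul_inv, le_div_iff₀ hu1]
  rcases le_total |t ^ 2 * u| (δ * t) with h | h
  · refine le_trans ?_ (le_max_left _ _)
    have h1 := saddleLog_re_le ht (t ^ 2 * u)
    have h2 : (t ^ 2 * u) ^ 2 / 2 * moment 1 t = u ^ 2 / 2 * (t ^ 4 * moment 1 t) := by ring
    have h3 : 4 * |t ^ 2 * u| ^ 3 * moment 2 t ≤ A * u ^ 2 := by
      have hm2 : 0 ≤ moment 2 t := (hasSum_moment 2 ht).nonneg fun n =>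
        mul_nonneg (logCoeff_nonneg t n) (by positivity)
      calc 4 * |t ^ 2 * u| ^ 3 * moment 2 t
          = 4 * |t ^ 2 * u| * (t ^ 4 * u ^ 2) * moment 2 t := by
            have : |t ^ 2 * u| ^ 3 = |t ^ 2 * u| * (t ^ 4 * u ^ 2) := by
              rw [pow_succ', sq_abs]
              ring
            rw [this]
            ring
        _ ≤ 4 * (δ * t) * (t ^ 4 * u ^ 2) * moment 2 t := by gcongr
        _ = 4 * δ * u ^ 2 * (t ^ 5 * moment 2 t) := by ring
        _ ≤ 4 * δ * u ^ 2 * C := by gcongr; exact hM2 t ht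
        _ = A * u ^ 2 := by rw [hδ]; field_simp
    have h4 : (saddleLog t (t ^ 2 * u)).re ≤ -(A * u ^ 2) := by nlinarith [sq_nonneg u]
    have h5 : Real.exp (saddleLog t (t ^ 2 * u)).re * (1 + A * u ^ 2) ≤ 1 := by
      calc Real.exp (saddleLog t (t ^ 2 * u)).re * (1 + A * u ^ 2)
          ≤ Real.exp (-(A * u ^ 2)) * Real.exp (A * u ^ 2) := by
            gcongr
            linarith [Real.add_one_le_exp (A * u ^ 2)]
        _ = 1 := by rw [← Real.exp_add]; simp
    calc Real.exp (saddleLog t (t ^ 2 * u)).re * (1 + u ^ 2)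
        ≤ Real.exp (saddleLog t (t ^ 2 * u)).re * ((1 + 1 / A) * (1 + A * u ^ 2)) := by
          gcongr
          have : (1 + 1 / A) * (1 + A * u ^ 2) = 1 + u ^ 2 + 1 / A + A * u ^ 2 := by
            field_simp
            ring
          rw [this]
          have h6 : 0 ≤ 1 / A := by positivity
          have h7 : 0 ≤ A * u ^ 2 := by positivity
          linarith
      _ = (1 + 1 / A) * (Real.exp (saddleLog t (t ^ 2 * u)).re * (1 + A * u ^ 2)) := by ring
      _ ≤ (1 + 1 / A) * 1 := by gcongr
      _ = 1 + 1 / A := mul_one _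
  · refine le_trans ?_ (le_max_right _ _)
    have h1 := hfar t (t ^ 2 * u) ht ht1 h hu
    have h2 : Real.exp (saddleLog t (t ^ 2 * u)).re ≤ 24 / c ^ 4 * t ^ 4 := by
      have h3 := Real.pow_div_factorial_le_exp (x := c / t) (by positivity) 4
      have h4 : Real.exp (-(c / t)) ≤ ((c / t) ^ 4 / (Nat.factorial 4 : ℝ))⁻¹ := by
        rw [Real.exp_neg]
        exact inv_anti₀ (by positivity) h3
      refine (Real.exp_le_exp.2 h1).trans (h4.trans (le_of_eq ?_))
      norm_num [Nat.factorial]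
      field_simp
    have h3 : t ^ 4 * (1 + u ^ 2) ≤ 1 + Real.pi ^ 2 := by
      have h4 : (t ^ 2 * u) ^ 2 ≤ Real.pi ^ 2 := by
        rw [← sq_abs]
        exact pow_le_pow_left₀ (abs_nonneg _) hu 2
      have h5 : t ^ 4 ≤ 1 := pow_le_one₀ ht.le ht1
      nlinarith
    calc Real.exp (saddleLog t (t ^ 2 * u)).re * (1 + u ^ 2)
        ≤ 24 / c ^ 4 * t ^ 4 * (1 + u ^ 2) := by gcongr
      _ = 24 / c ^ 4 * (t ^ 4 * (1 + u ^ 2)) := by ring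
      _ ≤ _ := by gcongr

theorem continuous_saddleLog {t : ℝ} (ht : 0 < t) : Continuous (saddleLog t) := by
  have h : Continuous fun θ : ℝ => logGenFun (Complex.exp (-t + θ * Complex.I)) := by
    simp_rw [logGenFun_cexp]
    refine continuous_tsum (fun n => by fun_prop) (summable_logCoeff ht) fun n θ => ?_
    rw [norm_mul, Complex.norm_exp_ofReal_mul_I, mul_one, Complex.norm_real,
      Real.norm_of_nonneg (logCoeff_nonneg t n)]
  unfold saddleLog
  fun_prop

theorem tendsto_saddleLog (u : ℝ) :
    Tendsto (fun t => saddleLog t (t ^ 2 * u)) (𝓝[>] 0) (𝓝 (-(3 * saddleConst * u ^ 2 : ℝ))) := by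
  obtain ⟨C, hC, hM2⟩ := moment_two_le
  have h0 : Tendsto (fun t : ℝ => t) (𝓝[>] 0) (𝓝 0) := tendsto_id.mono_left nhdsWithin_le_nhds
  have h1 : Tendsto (fun t => saddleLog t (t ^ 2 * u) +
      (((t ^ 2 * u) ^ 2 / 2 * moment 1 t : ℝ) : ℂ)) (𝓝[>] 0) (𝓝 0) := by
    have hb : Tendsto (fun t : ℝ => 4 * |u| ^ 3 * C * t) (𝓝[>] 0) (𝓝 0) := by
      simpa using h0.const_mul (4 * |u| ^ 3 * C)
    refine squeeze_zero_norm' ?_ hb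
    filter_upwards [self_mem_nhdsWithin] with t ht
    have ht' : 0 < t := ht
    have h2 := norm_saddleLog_add_le ht' (t ^ 2 * u)
    push_cast at h2 ⊢
    refine h2.trans ?_
    have h3 : 4 * |t ^ 2 * u| ^ 3 * moment 2 t = 4 * |u| ^ 3 * t * (t ^ 5 * moment 2 t) := by
      rw [abs_mul, abs_of_pos (pow_pos ht' 2)]
      ring
    rw [h3]
    calc 4 * |u| ^ 3 * t * (t ^ 5 * moment 2 t) ≤ 4 * |u| ^ 3 * t * C := by
          gcongr
          exact hM2 t ht'
      _ = _ := by ring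
  have h2 : Tendsto (fun t : ℝ => (((t ^ 2 * u) ^ 2 / 2 * moment 1 t : ℝ) : ℂ)) (𝓝[>] 0)
      (𝓝 ((3 * saddleConst * u ^ 2 : ℝ) : ℂ)) := by
    refine (Complex.continuous_ofReal.tendsto _).comp ?_
    have h3 := tendsto_moment_one.const_mul (u ^ 2 / 2)
    refine (h3.congr fun t => by ring).trans (le_of_eq ?_)
    congr 1
    ring
  have h3 := h1.sub h2
  rw [zero_sub] at h3
  exact h3.congr fun t => by ring

/-- Substituting θ = t² u and using dominated convergence gives a limit independent of `h`. It is
applied with `h = poleFactor` for the total number of steps and `h = 1` for the number of paths. -/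
theorem tendsto_saddle_integral {h : ℝ → ℝ → ℂ} (hcont : ∀ t, 0 < t → Continuous (h t))
    (hbound : ∀ t θ, 0 < t → t ≤ 1 → ‖h t θ‖ ≤ 2)
    (hlim : ∀ u : ℝ, Tendsto (fun t => h t (t ^ 2 * u)) (𝓝[>] 0) (𝓝 1)) :
    Tendsto (fun t : ℝ => ((t ^ 2 : ℝ) : ℂ)⁻¹ * ∫ θ in (-Real.pi)..Real.pi,
      h t θ * Complex.exp (saddleLog t θ)) (𝓝[>] 0)
      (𝓝 ((∫ u : ℝ, Real.exp (-(3 * saddleConst) * u ^ 2) : ℝ) : ℂ)) := by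
  obtain ⟨K, t₀, ht₀, ht₀1, hK⟩ := exists_norm_cexp_saddleLog_le
  set F : ℝ → ℝ → ℂ := fun t => (Set.Ioc (-Real.pi / t ^ 2) (Real.pi / t ^ 2)).indicator
    fun u => h t (t ^ 2 * u) * Complex.exp (saddleLog t (t ^ 2 * u)) with hF
  have hπ := Real.pi_pos
  have hpos : ∀ᶠ t in 𝓝[>] (0 : ℝ), 0 < t := self_mem_nhdsWithin
  have hsmall : ∀ᶠ t in 𝓝[>] (0 : ℝ), t ≤ t₀ :=
    (ge_mem_nhds ht₀).filter_mono nhdsWithin_le_nhds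
  have hint : ∀ t : ℝ, 0 < t → ∫ u, F t u = ((t ^ 2 : ℝ) : ℂ)⁻¹ * ∫ θ in (-Real.pi)..Real.pi,
      h t θ * Complex.exp (saddleLog t θ) := by
    intro t ht
    have ht2 : (0 : ℝ) < t ^ 2 := by positivity
    rw [hF, integral_indicator measurableSet_Ioc,
      ← intervalIntegral.integral_of_le (by gcongr; linarith),
      intervalIntegral.integral_comp_mul_left
        (fun θ => h t θ * Complex.exp (saddleLog t θ)) ht2.ne',
      mul_div_cancel₀ _ ht2.ne', mul_div_cancel₀ _ ht2.ne', Complex.real_smul, Complex.ofReal_inv]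
  have key : Tendsto (fun t => ∫ u, F t u) (𝓝[>] 0)
      (𝓝 (∫ u : ℝ, Complex.exp (-(3 * saddleConst * u ^ 2 : ℝ)))) := by
    refine tendsto_integral_filter_of_dominated_convergence (fun u => 2 * (K * (1 + u ^ 2)⁻¹)) ?_ ?_
      ((integrable_inv_one_add_sq.const_mul K).const_mul 2) ?_
    · filter_upwards [hpos] with t ht
      refine AEStronglyMeasurable.indicator ?_ measurableSet_Ioc
      have h1 := hcont t ht
      have h2 := continuous_saddleLog ht
      exact (by fun_prop : Continuous fun u => h t (t ^ 2 * u) *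
        Complex.exp (saddleLog t (t ^ 2 * u))).aestronglyMeasurable
    · filter_upwards [hpos, hsmall] with t ht htle
      refine Eventually.of_forall fun u => ?_
      rw [hF]
      dsimp only
      by_cases hu : u ∈ Set.Ioc (-Real.pi / t ^ 2) (Real.pi / t ^ 2)
      · rw [Set.indicator_of_mem hu, norm_mul]
        have ht2 : (0 : ℝ) < t ^ 2 := by positivity
        have hu' : |t ^ 2 * u| ≤ Real.pi := by
          rw [abs_le]
          have h1 := (div_lt_iff₀ ht2).1 hu.1
          have h2 := (le_div_iff₀ ht2).1 hu.2
          constructor <;> linarith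
        exact mul_le_mul (hbound t _ ht (htle.trans ht₀1)) (hK t u ht htle hu') (norm_nonneg _)
          (by norm_num)
      · rw [Set.indicator_of_notMem hu, norm_zero]
        have hK0 : 0 ≤ K := by
          have := hK t₀ 0 ht₀ le_rfl (by simp [hπ.le])
          have h2 := (norm_nonneg _).trans this
          simpa using h2
        positivity
    · refine Eventually.of_forall fun u => ?_
      have h1 : Tendsto (fun t => h t (t ^ 2 * u) * Complex.exp (saddleLog t (t ^ 2 * u)))
          (𝓝[>] 0) (𝓝 (1 * Complex.exp (-(3 * saddleConst * u ^ 2 : ℝ)))) :=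
        (hlim u).mul ((Complex.continuous_exp.tendsto _).comp (tendsto_saddleLog u))
      rw [one_mul] at h1
      refine h1.congr' ?_
      have h2 : Tendsto (fun t : ℝ => t ^ 2 * |u|) (𝓝[>] 0) (𝓝 0) := by
        have : Tendsto (fun t : ℝ => t ^ 2 * |u|) (𝓝 0) (𝓝 (0 ^ 2 * |u|)) :=
          ((continuous_id.pow 2).mul continuous_const).tendsto 0
        rw [zero_pow two_ne_zero, zero_mul] at this
        exact this.mono_left nhdsWithin_le_nhds
      filter_upwards [hpos, h2.eventually (gt_mem_nhds hπ)] with t ht hlt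
      have ht2 : (0 : ℝ) < t ^ 2 := by positivity
      rw [hF]
      dsimp only
      rw [Set.indicator_of_mem]
      rw [Set.mem_Ioc, div_lt_iff₀ ht2, le_div_iff₀ ht2]
      constructor
      · nlinarith [neg_abs_le u]
      · nlinarith [le_abs_self u]
  have e : ∫ u : ℝ, Complex.exp (-(3 * saddleConst * u ^ 2 : ℝ)) =
      ((∫ u : ℝ, Real.exp (-(3 * saddleConst) * u ^ 2) : ℝ) : ℂ) := by
    rw [← integral_complex_ofReal]
    refine integral_congr_ae (Eventually.of_forall fun u => ?_)
    push_cast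
    congr 1
    ring
  rw [e] at key
  refine key.congr' ?_
  filter_upwards [hpos] with t ht using hint t ht

/-- The factor `t z / (1 - z)` at `z = e^{-t + iθ}`. -/
noncomputable def poleFactor (t θ : ℝ) : ℂ :=
  t * (Complex.exp (-t + θ * Complex.I) / (1 - Complex.exp (-t + θ * Complex.I)))

theorem one_sub_cexp_ne_zero {t : ℝ} (ht : 0 < t) (θ : ℝ) :
    1 - Complex.exp (-t + θ * Complex.I) ≠ 0 :=
  norm_pos_iff.1 ((one_sub_exp_neg_pos ht).trans_le (one_sub_exp_neg_le_norm t θ))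

theorem continuous_poleFactor {t : ℝ} (ht : 0 < t) : Continuous (poleFactor t) := by
  unfold poleFactor
  refine continuous_const.mul (Continuous.div (by fun_prop) (by fun_prop) fun θ => ?_)
  exact one_sub_cexp_ne_zero ht θ

theorem norm_poleFactor_le {t θ : ℝ} (ht : 0 < t) (ht1 : t ≤ 1) : ‖poleFactor t θ‖ ≤ 2 := by
  rw [poleFactor, norm_mul, norm_div, norm_cexp_neg_add_mul_I, Complex.norm_real,
    Real.norm_of_nonneg ht.le]
  have h1 := one_sub_exp_neg_pos ht
  calc t * (Real.exp (-t) / ‖1 - Complex.exp (-t + θ * Complex.I)‖)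
      ≤ t * (1 / (1 - Real.exp (-t))) := by
        gcongr
        · exact Real.exp_le_one_iff.2 (by linarith)
        · exact one_sub_exp_neg_le_norm t θ
    _ = t / (1 - Real.exp (-t)) := mul_one_div _ _
    _ ≤ 1 + t := div_one_sub_exp_neg_le ht
    _ ≤ 2 := by linarith

/-- Since t² u is negligible against t, the curve z(t) = e^{-t + i t² u} has derivative -1 at 0, so
(1 - z) / t → 1. -/
theorem tendsto_poleFactor (u : ℝ) :
    Tendsto (fun t => poleFactor t (t ^ 2 * u)) (𝓝[>] 0) (𝓝 1) := by
  have hd : HasDerivAt (fun t : ℝ => Complex.exp (-t + ((t ^ 2 * u : ℝ) : ℂ) * Complex.I)) (-1) 0 := by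
    have h1 : HasDerivAt (fun t : ℝ => (t : ℂ)) 1 0 := Complex.ofRealCLM.hasDerivAt
    have h2 : HasDerivAt (fun t : ℝ => (-t + ((t ^ 2 * u : ℝ) : ℂ) * Complex.I : ℂ)) (-1) 0 := by
      have h3 := h1.neg.add (((h1.pow 2).mul_const (u : ℂ)).mul_const Complex.I)
      refine (h3.congr_deriv (by simp)).congr_of_eventuallyEq (Eventually.of_forall fun t => ?_)
      push_cast
      rfl
    refine h2.cexp.congr_deriv ?_
    simp
  have h1 := hd.tendsto_slope_zero_right
  have h2 : Tendsto (fun t : ℝ => Complex.exp (-t + ((t ^ 2 * u : ℝ) : ℂ) * Complex.I)) (𝓝[>] 0)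
      (𝓝 1) := by
    have := hd.continuousAt.tendsto
    simp only [Complex.ofReal_zero, neg_zero, ne_eq, OfNat.ofNat_ne_zero, not_false_eq_true,
      zero_pow, zero_mul, add_zero, Complex.exp_zero] at this
    exact this.mono_left nhdsWithin_le_nhds
  have h3 := h2.div h1.neg (by simp)
  simp only [neg_neg, div_one] at h3
  refine h3.congr' ?_
  filter_upwards [self_mem_nhdsWithin] with t ht
  have ht' : (t : ℂ) ≠ 0 := by exact_mod_cast (show (0 : ℝ) < t from ht).ne'
  have h4 := one_sub_cexp_ne_zero ht (t ^ 2 * u)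
  simp only [Pi.div_apply, zero_add, Complex.ofReal_zero, neg_zero, ne_eq,
    OfNat.ofNat_ne_zero, not_false_eq_true, zero_pow, zero_mul, add_zero, Complex.exp_zero,
    Complex.real_smul, Complex.ofReal_inv, poleFactor]
  rw [← mul_neg, neg_sub]
  field_simp

end NWPath

namespace NWPath

open scoped Topology

/-! ### The asymptotic mean -/

/-- The saddle point equation `hn` cancels the terms linear in θ. -/
theorem cexp_logGenFun_mul {t : ℝ} {n : ℕ} (hn : moment 0 t = n) (θ : ℝ) :
    Complex.exp (logGenFun (Complex.exp (-t + θ * Complex.I))) *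
      Complex.exp (-(n * (-t + θ * Complex.I))) =
    Complex.exp (logGenFun (Complex.exp (-t)) + n * t) * Complex.exp (saddleLog t θ) := by
  rw [← Complex.exp_add, ← Complex.exp_add, saddleLog, hn]
  congr 1
  push_cast
  ring

/-- The value of the integrand at the saddle point is a common factor of both integrals and cancels.
-/
theorem mul_totalSteps_div_pathCount {t : ℝ} (ht : 0 < t) {n : ℕ} (hn : moment 0 t = n) :
    ((t * (totalSteps n / pathCount n) : ℝ) : ℂ) =
      (((t ^ 2 : ℝ) : ℂ)⁻¹ * ∫ θ in (-Real.pi)..Real.pi,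
        poleFactor t θ * Complex.exp (saddleLog t θ)) /
      (((t ^ 2 : ℝ) : ℂ)⁻¹ * ∫ θ in (-Real.pi)..Real.pi, 1 * Complex.exp (saddleLog t θ)) := by
  have ht0 : (t : ℂ) ≠ 0 := by exact_mod_cast ht.ne'
  have hπ : (Real.pi : ℂ) ≠ 0 := by exact_mod_cast Real.pi_pos.ne'
  have hc0 : (pathCount n : ℂ) ≠ 0 := by exact_mod_cast (pathCount_pos n).ne'
  set E := Complex.exp (logGenFun (Complex.exp (-t)) + n * t)
  have h1 : E * ∫ θ in (-Real.pi)..Real.pi, 1 * Complex.exp (saddleLog t θ) =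
      2 * Real.pi * pathCount n := by
    have h := integral_pathCount ht n
    simp_rw [cexp_logGenFun_mul hn] at h
    rw [intervalIntegral.integral_const_mul] at h
    simpa using h
  have h2 : E * ∫ θ in (-Real.pi)..Real.pi, poleFactor t θ * Complex.exp (saddleLog t θ) =
      2 * Real.pi * (t * totalSteps n) := by
    have h := integral_totalSteps ht n
    simp_rw [mul_assoc (_ / _), cexp_logGenFun_mul hn] at h
    have e : ∀ θ : ℝ, poleFactor t θ * Complex.exp (saddleLog t θ) = t * E⁻¹ *
        (Complex.exp (-t + θ * Complex.I) / (1 - Complex.exp (-t + θ * Complex.I)) *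
          (E * Complex.exp (saddleLog t θ))) := by
      intro θ
      have hE : E ≠ 0 := Complex.exp_ne_zero _
      rw [poleFactor]
      field_simp
    simp_rw [e]
    rw [intervalIntegral.integral_const_mul, h]
    have hE : E ≠ 0 := Complex.exp_ne_zero _
    field_simp
    push_cast
    ring
  have hE : E ≠ 0 := Complex.exp_ne_zero _
  have ht2 : (((t ^ 2 : ℝ) : ℂ)⁻¹) ≠ 0 := by
    push_cast
    exact inv_ne_zero (pow_ne_zero 2 ht0)
  rw [mul_div_mul_left _ _ ht2, ← mul_div_mul_left _ _ hE, h1, h2,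
    mul_div_mul_left _ _ (mul_ne_zero two_ne_zero hπ)]
  push_cast
  ring

theorem gaussian_integral_ne_zero :
    ((∫ u : ℝ, Real.exp (-(3 * saddleConst) * u ^ 2) : ℝ) : ℂ) ≠ 0 := by
  have h := saddleConst_pos
  rw [integral_gaussian]
  exact_mod_cast (Real.sqrt_pos.2 (div_pos Real.pi_pos (by positivity))).ne'

theorem tendsto_saddle_ratio {t : ℕ → ℝ} (ht : Tendsto t atTop (𝓝[>] 0))
    (hpos : ∀ᶠ n in atTop, 0 < t n) (hn : ∀ᶠ n : ℕ in atTop, moment 0 (t n) = n) :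
    Tendsto (fun n => t n * ((totalSteps n : ℝ) / pathCount n)) atTop (𝓝 1) := by
  have h1 := tendsto_saddle_integral (h := poleFactor) (fun t ht => continuous_poleFactor ht)
    (fun t θ ht ht1 => norm_poleFactor_le ht ht1) tendsto_poleFactor
  have h2 := tendsto_saddle_integral (h := fun _ _ => 1) (fun t ht => continuous_const)
    (fun t θ ht ht1 => by norm_num) (fun u => tendsto_const_nhds)
  have h3 := (h1.div h2 gaussian_integral_ne_zero).comp ht
  rw [div_self gaussian_integral_ne_zero] at h3
  have h4 := (Complex.continuous_re.tendsto 1).comp h3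
  rw [Complex.one_re] at h4
  refine h4.congr' ?_
  filter_upwards [hpos, hn] with n hn1 hn2
  have h5 := congrArg Complex.re (mul_totalSteps_div_pathCount hn1 hn2)
  rw [Complex.ofReal_re] at h5
  exact h5.symm

/-! ### Existence and size of the saddle point. -/

theorem continuousOn_moment_zero : ContinuousOn (moment 0) (Set.Ioi 0) := by
  intro t ht
  have ht' : 0 < t := ht
  have h : ContinuousOn (moment 0) (Set.Ioi (t / 2)) := by
    refine continuousOn_tsum (u := fun n : ℕ => (n : ℝ) ^ 0 * totientSum n * Real.exp (-(n * (t / 2))))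
      (fun n => by fun_prop) ?_ fun n x hx => ?_
    · simp_rw [exp_neg_nat_mul]
      exact summable_totientSum_mul_pow (Real.exp_nonneg _)
        (Real.exp_lt_one_iff.2 (by linarith)) 0
    · have hx' : t / 2 < x := hx
      rw [Real.norm_of_nonneg (by positivity)]
      gcongr
  exact (h.continuousAt (Ioi_mem_nhds (by linarith))).continuousWithinAt

theorem exists_moment_zero_le : ∃ C, 0 < C ∧ ∀ t, 0 < t → t ^ 3 * moment 0 t ≤ C := by
  obtain ⟨C, hC⟩ := (hasAbelLimit_totientSum (i := 0) hasAbelLimit_sq).1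
  exact ⟨max C 1, by positivity, fun t ht =>
    (le_abs_self _).trans ((hC t ht).trans (le_max_left _ _))⟩

/-- Intermediate values: `moment 0` grows like t⁻³ near 0 and is at most C / t³ everywhere. -/
theorem exists_moment_zero_eq {y : ℝ} (hy : 0 < y) : ∃ t, 0 < t ∧ moment 0 t = y := by
  obtain ⟨C, hC, hle⟩ := exists_moment_zero_le
  have hA := saddleConst_pos
  obtain ⟨a, ha, hay⟩ : ∃ a, 0 < a ∧ y ≤ moment 0 a := by
    have h1 : ∀ᶠ t in 𝓝[>] (0 : ℝ), saddleConst < t ^ 3 * moment 0 t :=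
      tendsto_moment_zero.eventually (lt_mem_nhds (by linarith))
    have h2 : Tendsto (fun t : ℝ => t ^ 3 * y) (𝓝[>] 0) (𝓝 0) := by
      have : Tendsto (fun t : ℝ => t ^ 3 * y) (𝓝 0) (𝓝 (0 ^ 3 * y)) :=
        ((continuous_id.pow 3).mul continuous_const).tendsto 0
      rw [zero_pow three_ne_zero, zero_mul] at this
      exact this.mono_left nhdsWithin_le_nhds
    have h3 : ∀ᶠ t in 𝓝[>] (0 : ℝ), 0 < t := self_mem_nhdsWithin
    obtain ⟨t, ht1, ht2, ht3⟩ := (h1.and ((h2.eventually (gt_mem_nhds hA)).and h3)).exists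
    exact ⟨t, ht3, (lt_of_mul_lt_mul_left (ht2.trans ht1) (by positivity)).le⟩
  obtain ⟨b, hb, hby⟩ : ∃ b, 0 < b ∧ moment 0 b ≤ y := by
    refine ⟨max 1 (C / y), by positivity, ?_⟩
    set b := max 1 (C / y)
    have hb1 : 1 ≤ b := le_max_left _ _
    have hb3 : b ≤ b ^ 3 := by nlinarith [sq_nonneg b]
    have h2 : C ≤ b * y := (div_le_iff₀ hy).1 (le_max_right _ _)
    have h3 := hle b (by linarith)
    refine le_of_mul_le_mul_left (a := b ^ 3) ?_ (by positivity)
    nlinarith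
  obtain ⟨t, ht, hty⟩ := isPreconnected_Ioi.intermediate_value (show b ∈ Set.Ioi 0 from hb)
    (show a ∈ Set.Ioi 0 from ha) continuousOn_moment_zero ⟨hby, hay⟩
  exact ⟨t, ht, hty⟩

theorem exists_saddle_points : ∃ t : ℕ → ℝ, (∀ n, 0 < t n) ∧
    (∀ᶠ n : ℕ in atTop, moment 0 (t n) = n) ∧ Tendsto t atTop (𝓝[>] 0) := by
  have h : ∀ n : ℕ, ∃ t, 0 < t ∧ (0 < n → moment 0 t = n) := by
    intro n
    rcases Nat.eq_zero_or_pos n with rfl | hn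
    -- A dummy value: the saddle point equation is imposed only for n > 0.
    · exact ⟨1, one_pos, fun h => absurd h (lt_irrefl 0)⟩
    · obtain ⟨t, ht, htn⟩ := exists_moment_zero_eq (y := n) (by exact_mod_cast hn)
      exact ⟨t, ht, fun _ => htn⟩
  choose t ht htn using h
  have hev : ∀ᶠ n : ℕ in atTop, moment 0 (t n) = n := by
    filter_upwards [eventually_gt_atTop 0] with n hn using htn n hn
  refine ⟨t, ht, hev, tendsto_nhdsWithin_iff.2 ⟨?_, Eventually.of_forall ht⟩⟩
  obtain ⟨C, hC, hle⟩ := exists_moment_zero_le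
  rw [tendsto_order]
  refine ⟨fun a ha => Eventually.of_forall fun n => ha.trans (ht n), fun ε hε => ?_⟩
  filter_upwards [hev, tendsto_natCast_atTop_atTop.eventually_gt_atTop (C / ε ^ 3)] with n hn hlt
  by_contra hcon
  have h1 : ε ^ 3 ≤ t n ^ 3 := pow_le_pow_left₀ hε.le (not_lt.1 hcon) 3
  have h2 := hle (t n) (ht n)
  rw [hn] at h2
  rw [div_lt_iff₀ (by positivity)] at hlt
  have h3 : (0 : ℝ) ≤ n := n.cast_nonneg
  nlinarith

/-- The asymptotic value of the mean number of initial vertical steps. -/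
noncomputable def asymptoticMean (n : ℕ) : ℝ :=
  (18 * Real.pi ^ 2 * (n : ℝ)) ^ (1 / 3 : ℝ) / (6 * (riemannZeta 3).re ^ (1 / 3 : ℝ))

theorem asymptoticMean_nonneg (n : ℕ) : 0 ≤ asymptoticMean n := by
  have := zeta_three_pos
  unfold asymptoticMean
  positivity

theorem asymptoticMean_cube (n : ℕ) : asymptoticMean n ^ 3 = n / (2 * saddleConst) := by
  have hz := zeta_three_pos
  have h (x : ℝ) (hx : 0 ≤ x) : (x ^ (1 / 3 : ℝ)) ^ 3 = x := by
    rw [← Real.rpow_natCast, ← Real.rpow_mul hx]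
    norm_num
  rw [asymptoticMean, div_pow, mul_pow, h _ (by positivity), h _ hz.le, saddleConst]
  have := Real.pi_pos
  field_simp
  ring

theorem asymptoticMean_eq (n : ℕ) :
    asymptoticMean n = (1 / (2 * saddleConst)) ^ (1 / 3 : ℝ) * (n : ℝ) ^ (1 / 3 : ℝ) := by
  have hA := saddleConst_pos
  rw [← Real.mul_rpow (by positivity) (by positivity), one_div_mul_eq_div, ← asymptoticMean_cube,
    ← Real.rpow_natCast, ← Real.rpow_mul (asymptoticMean_nonneg n)]
  norm_num

theorem asymptoticMean_pos {n : ℕ} (hn : 0 < n) : 0 < asymptoticMean n := by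
  have hA := saddleConst_pos
  have : (0 : ℝ) < n := by exact_mod_cast hn
  rw [asymptoticMean_eq]
  positivity

theorem tendsto_asymptoticMean : Tendsto asymptoticMean atTop atTop := by
  have hA := saddleConst_pos
  have h := ((tendsto_rpow_atTop (by norm_num : (0 : ℝ) < 1 / 3)).comp
    tendsto_natCast_atTop_atTop).const_mul_atTop
    (by positivity : 0 < (1 / (2 * saddleConst)) ^ (1 / 3 : ℝ))
  exact h.congr fun n => (asymptoticMean_eq n).symm

theorem tendsto_asymptoticMean_div_succ :
    Tendsto (fun n : ℕ => asymptoticMean n / asymptoticMean (n + 1)) atTop (𝓝 1) := by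
  have hA := saddleConst_pos
  have h : Tendsto (fun n : ℕ => ((n : ℝ) / (n + 1)) ^ (1 / 3 : ℝ)) atTop (𝓝 (1 ^ (1 / 3 : ℝ))) :=
    (tendsto_natCast_div_add_atTop (1 : ℝ)).rpow_const (Or.inl one_ne_zero)
  rw [Real.one_rpow] at h
  refine h.congr fun n => ?_
  rw [asymptoticMean_eq, asymptoticMean_eq, mul_div_mul_left _ _ (by positivity),
    Real.div_rpow (by positivity) (by positivity)]
  push_cast
  rfl

/-- At the saddle point t³ n → 2 `saddleConst`, and the cube of `asymptoticMean n` is n / (2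
`saddleConst`). So t times `asymptoticMean n` tends to 1, as does t times the mean. -/
theorem tendsto_totalSteps_div :
    Tendsto (fun n : ℕ => (totalSteps n : ℝ) / pathCount n / asymptoticMean n) atTop (𝓝 1) := by
  obtain ⟨t, ht, hev, hlim⟩ := exists_saddle_points
  have hA := saddleConst_pos
  have h1 := tendsto_saddle_ratio hlim (Eventually.of_forall ht) hev
  have h2 : Tendsto (fun n => t n * asymptoticMean n) atTop (𝓝 1) := by
    have h3 := ((tendsto_moment_zero.comp hlim).div_const (2 * saddleConst)).rpow_const
      (p := (1 / 3 : ℝ)) (Or.inr (by norm_num))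
    rw [div_self (by positivity), Real.one_rpow] at h3
    refine h3.congr' ?_
    filter_upwards [hev] with n hn
    have h4 : 0 ≤ t n * asymptoticMean n := mul_nonneg (ht n).le (asymptoticMean_nonneg n)
    rw [Function.comp_apply, hn, mul_div_assoc, ← asymptoticMean_cube, ← mul_pow,
      ← Real.rpow_natCast, ← Real.rpow_mul h4]
    norm_num
  have h3 := h1.div h2 one_ne_zero
  rw [div_one] at h3
  exact h3.congr fun n => mul_div_mul_left _ _ (ht n).ne'

theorem isEquivalent_reducedPaths :
    (fun n : ℕ => meanInitialSteps (reducedPaths n)) ~[atTop] asymptoticMean := by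
  refine (isEquivalent_iff_tendsto_one ?_).2 ?_
  · filter_upwards [eventually_gt_atTop 0] with n hn using (asymptoticMean_pos hn).ne'
  · refine tendsto_totalSteps_div.congr fun n => ?_
    rw [Pi.div_apply, meanInitialSteps_reducedPaths]

/-- Restoring the first north step adds 1 to the mean and shifts n by one; both are negligible
because `asymptoticMean` tends to infinity and varies slowly. -/
theorem isEquivalent_paths :
    (fun n : ℕ => meanInitialSteps (paths n)) ~[atTop] asymptoticMean := by
  refine (isEquivalent_iff_tendsto_one ?_).2 ?_
  · filter_upwards [eventually_gt_atTop 0] with n hn using (asymptoticMean_pos hn).ne'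
  · rw [← tendsto_add_atTop_iff_nat 1]
    have h1 := (tendsto_totalSteps_div.add tendsto_asymptoticMean.inv_tendsto_atTop).mul
      tendsto_asymptoticMean_div_succ
    rw [add_zero, one_mul] at h1
    refine h1.congr' ?_
    filter_upwards [eventually_gt_atTop 0] with n hn
    have h2 := (asymptoticMean_pos hn).ne'
    have h3 := (asymptoticMean_pos n.succ_pos).ne'
    rw [Pi.div_apply, meanInitialSteps_paths_succ, Pi.inv_apply]
    field_simp

end NWPath

theorem mainTheorem8 :
    ((fun n : ℕ => NWPath.meanInitialSteps (NWPath.paths n)) ~[atTop]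
      fun n : ℕ => (18 * Real.pi ^ 2 * (n : ℝ)) ^ (1 / 3 : ℝ) /
        (6 * (riemannZeta 3).re ^ (1 / 3 : ℝ))) ∧
    ((fun n : ℕ => NWPath.meanInitialSteps (NWPath.reducedPaths n)) ~[atTop]
      fun n : ℕ => (18 * Real.pi ^ 2 * (n : ℝ)) ^ (1 / 3 : ℝ) /
        (6 * (riemannZeta 3).re ^ (1 / 3 : ℝ))) :=
  ⟨NWPath.isEquivalent_paths, NWPath.isEquivalent_reducedPaths⟩
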